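/- Let $\Sigma=\{0,1\}$. A promise problem is a function $\phi$ that assigns to every string over $\Sigma$ a non-empty set $\phi(x)\subseteq\Sigma$ of valid answers. For promise problems $\phi_1,\phi_2$ write $\phi_1\propto_T\phi_2$ if there are an oracle Turing machine $M$ and a polynomial $p$ such that, for every input $x$, every possible path of $M$ halts after at most $p(|x|)$ steps with output some $y\in\phi_1(x)$, where an oracle call with query $q$ takes one step and may return any element of $\phi_2(q)$ (chosen adversarially, and independently for different calls). Let $\widehat{\mathrm P}^{\phi}=\{\psi\mid\psi\propto_T\phi\}$. For $n\ge 1$ let $f:\Sigma^{m_1}\times\cdots\times\Sigma^{m_n}\to\Sigma$ (with $m_1\ge 1$) be given by the lengths $m_1,\dots,m_n$ and a boolean expression. Write $f_x$ for $f$ with its first argument fixed to $x\in\Sigma^{m_1}$, and let $$S_f=\{x\in\Sigma^{m_1}\mid \forall y^{(1)}\,\exists y^{(2)}\,\forall y^{(3)}\cdots\; f_x(y^{(1)},\dots,y^{(n-1)})=1\}$$ (with $n-1$ alternating quantifiers, $y^{(i)}\in\Sigma^{m_{i+1}}$). The promise problem $\mathrm{USAT}_n$ asks, under the promise $|S_f|\le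 1$, whether $S_f\neq\emptyset$ (answer $1$ if so, $0$ if not). The promise problem $\mathrm{UVAL}_n$ asks, under the promise $|S_f|=1$, for the first bit of the unique element of $S_f$. When the promise fails, or the input does not encode such an $f$, both answers are valid. Theorem. For every $n\ge 1$, $$\widehat{\mathrm P}^{\mathrm{UVAL}_n}=\widehat{\mathrm P}^{\mathrm{USAT}_n}.$$ In other words, let $\mathrm U\widehat\Delta_{n+1}:=\widehat{\mathrm P}^{\mathrm{USAT}_n}$, let $\mathrm U\widehat{\mathrm V}_n$ be the class of promise problems that are polynomial-time many-one reducible to $\mathrm{UVAL}_n$, and let $\widehat{\mathrm P}^{\mathrm U\widehat{\mathrm V}_n}:=\widehat{\mathrm P}^{\mathrm{UVAL}_n}$; then $\widehat{\mathrm P}^{\mathrm U\widehat{\mathrm V}_n}=\mathrm U\widehat\Delta_{n+1}$. -/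

import Mathlib

namespace PromiseHierarchy

/-! ### Promise problems -/

/-- A promise problem over the alphabet `Σ = {0, 1}`: it assigns to every string the non-empty set
of its valid answers, so the values are `{0}`, `{1}` and `Σ`. -/
def PromiseProblem : Type := List Bool → {A : Set Bool // A.Nonempty}

/-- The set of valid answers with value `A` where the promise `P` holds, and every answer is valid
where it does not. -/
def promise (A : Set Bool) (P : Prop) : Set Bool := {b | P → b ∈ A}

/-! ### Oracle Turing machines -/

/-- An oracle Turing machine, in the form of Mathlib's machine model `Turing.TM2` (finitely many
stacks, finitely many labels, finitely many internal states) extended by an oracle instruction.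
All stacks are over the alphabet `{0, 1}`. At each label stands either an ordinary statement
or an oracle call, together with the label at which the computation goes on after the call. -/
structure OracleTM where
  /-- The index set of the stacks. -/
  K : Type
  [decEqK : DecidableEq K]
  [finK : Fintype K]
  /-- The stack that holds the input at the start (first letter on top). -/
  inp : K
  /-- The stack that holds the query string of an oracle call, and the answer after the call. -/
  qry : K
  /-- The stack that holds the output at the end. -/
  out : K
  /-- The labels. -/
  L : Type
  [finL : Fintype L]
  /-- The label at which the computation starts. -/
  main : L
  /-- The internal states. -/
  Q : Type
  [finQ : Fintype Q]
  /-- The internal state in which the computation starts. -/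
  start : Q
  /-- The program. -/
  prog : L → Turing.TM2.Stmt (fun _ : K => Bool) L Q ⊕ L

attribute [instance] OracleTM.decEqK OracleTM.finK OracleTM.finL OracleTM.finQ

namespace OracleTM

/-- Configurations: the current label (`none` if the machine has halted), the internal state and
the contents of the stacks. -/
abbrev Cfg (M : OracleTM) : Type := Turing.TM2.Cfg (fun _ : M.K => Bool) M.L M.Q

/-- The initial configuration on input `x`. -/
def init (M : OracleTM) (x : List Bool) : M.Cfg :=
  ⟨some M.main, M.start, Function.update (fun _ => []) M.inp x⟩

/-- `M.Step φ c c'`: with an oracle for the promise problem `φ`, the machine may pass from `c` to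
`c'` in one step. An oracle call takes one step and replaces the contents `q` of the
query stack by one letter `y`, any element of `φ q`; nothing ties the choice of `y` to the
choices made in other calls. -/
inductive Step (M : OracleTM) (φ : PromiseProblem) : M.Cfg → M.Cfg → Prop
  | run {l : M.L} {s : Turing.TM2.Stmt (fun _ : M.K => Bool) M.L M.Q} (v : M.Q)
      (S : M.K → List Bool) (h : M.prog l = Sum.inl s) :
      Step M φ ⟨some l, v, S⟩ (Turing.TM2.stepAux s v S)
  | call {l l' : M.L} (v : M.Q) (S : M.K → List Bool) (y : Bool) (h : M.prog l = Sum.inr l')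
      (hy : y ∈ (φ (S M.qry)).1) :
      Step M φ ⟨some l, v, S⟩ ⟨some l', v, Function.update S M.qry [y]⟩

/-- `M.Path φ k c c'`: some path of exactly `k` steps leads from `c` to `c'`. -/
inductive Path (M : OracleTM) (φ : PromiseProblem) : ℕ → M.Cfg → M.Cfg → Prop
  | refl (c : M.Cfg) : Path M φ 0 c c
  | head {k : ℕ} {c₁ c₂ c₃ : M.Cfg} (h : M.Step φ c₁ c₂) (h' : Path M φ k c₂ c₃) :
      Path M φ (k + 1) c₁ c₃

end OracleTM

/-- Weak (Turing, Cook) reducibility `φ₁ ∝_T φ₂`: some oracle machine and some polynomial `p` are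
such that on every input `x`, every path of the machine with an oracle for `φ₂` has at most
`p(|x|)` steps, and if it has halted then its output is some `y ∈ φ₁ x`.
(Only halted configurations have no successor, so that every maximal path halts.) -/
def TuringReducible (φ₁ φ₂ : PromiseProblem) : Prop :=
  ∃ (M : OracleTM) (p : Polynomial ℕ), ∀ (x : List Bool) (k : ℕ) (c : M.Cfg),
    M.Path φ₂ k (M.init x) c →
      k ≤ p.eval x.length ∧ (c.l = none → ∃ y ∈ (φ₁ x).1, c.stk M.out = [y])

/-- The weak closure `P̂^φ`: all promise problems that are Turing reducible to `φ`. -/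
def weakClosure (φ : PromiseProblem) : Set PromiseProblem := {ψ | TuringReducible ψ φ}

/-! ### Functions of several strings, and alternating quantification -/

/-- Functions `Σ^{m₁} × ⋯ × Σ^{mₙ} → Σ`, in curried form. -/
def StrFun : List ℕ → Type
  | [] => Bool
  | m :: ms => (Fin m → Bool) → StrFun ms

mutual

/-- `SATₙ f = 1`, where `f` has `n` arguments: `∃ x⁽¹⁾, ∀ x⁽²⁾, ∃ x⁽³⁾, …, f x⁽¹⁾ … x⁽ⁿ⁾ = 1`. -/
def Sat : (ms : List ℕ) → StrFun ms → Prop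
  | [], f => f = true
  | m :: ms, f => ∃ x : Fin m → Bool, CoSat ms (f x)

/-- The dual problem: `∀ x⁽¹⁾, ∃ x⁽²⁾, ∀ x⁽³⁾, …, f x⁽¹⁾ … x⁽ⁿ⁾ = 1`. -/
def CoSat : (ms : List ℕ) → StrFun ms → Prop
  | [], f => f = true
  | m :: ms, f => ∀ x : Fin m → Bool, Sat ms (f x)

end

/-- The set of all `x` such that the dual problem of level `n - 1` has answer `1` at `f_x`, where
`f` has `n` arguments. -/
def solutions {m : ℕ} {ms : List ℕ} (f : StrFun (m :: ms)) : Set (Fin m → Bool) :=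
  {x | CoSat ms (f x)}

/-- The valid answers of `USATₙ` at `f`: the answer of `SATₙ`, under the promise that `f` has at
most one solution. -/
def usatAnswers {m : ℕ} {ms : List ℕ} (f : StrFun (m :: ms)) : Set Bool :=
  promise {b | b = true ↔ Sat (m :: ms) f} ((solutions f).encard ≤ 1)

/-- The valid answers of `UVALₙ` at `f`: the first letter of the solution, under the promise that
`f` has exactly one solution. -/
def uvalAnswers {m : ℕ} {ms : List ℕ} (hm : 0 < m) (f : StrFun (m :: ms)) : Set Bool :=
  promise ((fun x : Fin m → Bool => x ⟨0, hm⟩) '' solutions f) (∃! x, x ∈ solutions f)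

/-! ### Encoding of functions by boolean expressions -/

/-- Boolean expressions; `var i j` is the `j`-th letter of the `i`-th string argument (both counted
from `0`). -/
inductive Expr : Type
  | var (i j : ℕ)
  | not (e : Expr)
  | and (e₁ e₂ : Expr)
  | or (e₁ e₂ : Expr)

namespace Expr

/-- The value of an expression at an assignment. -/
def eval (a : ℕ → ℕ → Bool) : Expr → Bool
  | var i j => a i j
  | not e => !(e.eval a)
  | and e₁ e₂ => e₁.eval a && e₂.eval a
  | or e₁ e₂ => e₁.eval a || e₂.eval a

/-- All variables of the expression are letters of string arguments of the lengths `ms`. -/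
def Scoped (ms : List ℕ) : Expr → Prop
  | var i j => j < ms.getD i 0
  | not e => e.Scoped ms
  | and e₁ e₂ => e₁.Scoped ms ∧ e₂.Scoped ms
  | or e₁ e₂ => e₁.Scoped ms ∧ e₂.Scoped ms

/-- The function that is given by the expression, where the arguments from the `k`-th one on have
the lengths `ms`, and the assignment `a` has been fixed for the earlier ones. -/
def toFunFrom (e : Expr) : (ms : List ℕ) → (k : ℕ) → (a : ℕ → ℕ → Bool) → StrFun ms
  | [], _, a => e.eval a
  | m :: ms, k, a => fun x : Fin m → Bool =>
      e.toFunFrom ms (k + 1)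
        (Function.update a k (fun j => if h : j < m then x ⟨j, h⟩ else false))

/-- The function `Σ^{m₁} × ⋯ × Σ^{mₙ} → Σ` that is given by the expression. -/
def toFun (e : Expr) (ms : List ℕ) : StrFun ms := e.toFunFrom ms 0 (fun _ _ => false)

end Expr

/-- The self-delimiting unary code `1ᵏ0` of a number. -/
def unary (k : ℕ) : List Bool := List.replicate k true ++ [false]

/-- The code of an expression, in prefix notation. -/
def Expr.encode : Expr → List Bool
  | .var i j => [false, false] ++ unary i ++ unary j
  | .not e => [false, true] ++ e.encode
  | .and e₁ e₂ => [true, false] ++ e₁.encode ++ e₂.encode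
  | .or e₁ e₂ => [true, true] ++ e₁.encode ++ e₂.encode

/-- The instances of the problems of level `n`: a function `Σ^{m₁} × ⋯ × Σ^{mₙ} → Σ` with
`m₁ ≥ 1`, given by the lengths `m₁` (`first`) and `m₂, …, mₙ` (`rest`) and an expression. -/
structure Instance (n : ℕ) where
  first : ℕ
  rest : List ℕ
  expr : Expr
  first_pos : 0 < first
  level : rest.length + 1 = n
  expr_scoped : expr.Scoped (first :: rest)

/-- The function of an instance. -/
def Instance.fn {n : ℕ} (I : Instance n) : StrFun (I.first :: I.rest) :=
  I.expr.toFun (I.first :: I.rest)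

/-- The string that encodes an instance. -/
def Instance.encode {n : ℕ} (I : Instance n) : List Bool :=
  (I.first :: I.rest).flatMap unary ++ I.expr.encode

theorem unary_append_inj {k l : ℕ} {s t : List Bool} (h : unary k ++ s = unary l ++ t) :
    k = l ∧ s = t := by
  induction k generalizing l with
  | zero => cases l <;> simp_all [unary, List.replicate_succ]
  | succ k ih =>
    cases l with
    | zero => simp [unary, List.replicate_succ] at h
    | succ l =>
      have := @ih l (by simpa [unary, List.replicate_succ] using h)
      simp [this]

theorem flatMap_unary_append_inj {l₁ l₂ : List ℕ} {s t : List Bool}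
    (hl : l₁.length = l₂.length) (h : l₁.flatMap unary ++ s = l₂.flatMap unary ++ t) :
    l₁ = l₂ ∧ s = t := by
  induction l₁ generalizing l₂ with
  | nil => cases l₂ <;> simp_all
  | cons k l₁ ih =>
    cases l₂ with
    | nil => simp at hl
    | cons l l₂ =>
      rw [List.flatMap_cons, List.flatMap_cons, List.append_assoc, List.append_assoc] at h
      obtain ⟨rfl, h'⟩ := unary_append_inj h
      obtain ⟨rfl, h''⟩ := ih (by simpa using hl) h'
      exact ⟨rfl, h''⟩

theorem Expr.encode_append_inj {e₁ e₂ : Expr} {s t : List Bool}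
    (h : e₁.encode ++ s = e₂.encode ++ t) : e₁ = e₂ ∧ s = t := by
  induction e₁ generalizing e₂ s t with
  | var i j =>
    cases e₂ <;> simp only [Expr.encode, List.append_assoc, List.cons_append, List.nil_append,
      List.cons.injEq, reduceCtorEq, false_and, and_false, true_and] at h
    obtain ⟨rfl, h'⟩ := unary_append_inj h
    obtain ⟨rfl, h''⟩ := unary_append_inj h'
    exact ⟨rfl, h''⟩
  | not e ih =>
    cases e₂ <;> simp only [Expr.encode, List.append_assoc, List.cons_append, List.nil_append,
      List.cons.injEq, reduceCtorEq, false_and, and_false, true_and] at h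
    obtain ⟨rfl, h'⟩ := ih h
    exact ⟨rfl, h'⟩
  | and e e' ih ih' =>
    cases e₂ <;> simp only [Expr.encode, List.append_assoc, List.cons_append, List.nil_append,
      List.cons.injEq, reduceCtorEq, false_and, and_false, true_and] at h
    obtain ⟨rfl, h'⟩ := ih h
    obtain ⟨rfl, h''⟩ := ih' h'
    exact ⟨rfl, h''⟩
  | or e e' ih ih' =>
    cases e₂ <;> simp only [Expr.encode, List.append_assoc, List.cons_append, List.nil_append,
      List.cons.injEq, reduceCtorEq, false_and, and_false, true_and] at h
    obtain ⟨rfl, h'⟩ := ih h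
    obtain ⟨rfl, h''⟩ := ih' h'
    exact ⟨rfl, h''⟩

/-- Different instances have different codes. -/
theorem Instance.encode_injective (n : ℕ) :
    Function.Injective (Instance.encode : Instance n → List Bool) := by
  rintro ⟨m, ms, e, h₁, h₂, h₃⟩ ⟨m', ms', e', h₁', h₂', h₃'⟩ h
  have hl : (m :: ms).length = (m' :: ms').length := h₂.trans h₂'.symm
  obtain ⟨h, h'⟩ := flatMap_unary_append_inj hl h
  obtain ⟨rfl, rfl⟩ := List.cons.inj h
  obtain ⟨rfl, -⟩ := Expr.encode_append_inj (s := []) (t := []) (by simpa using h')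
  rfl

/-! ### The problems of level `n` -/

/-- The promise problem whose inputs are the codes of the instances of level `n`, with the valid
answers `A I` at the code of `I`. On a string that is not a code, every answer is valid. -/
def ofInstances {n : ℕ} (A : Instance n → Set Bool) (hA : ∀ I, (A I).Nonempty) :
    PromiseProblem := fun s =>
  ⟨{b | ∀ I : Instance n, I.encode = s → b ∈ A I}, by
    by_cases h : ∃ I : Instance n, I.encode = s
    · obtain ⟨I, rfl⟩ := h
      obtain ⟨b, hb⟩ := hA I
      exact ⟨b, fun J hJ => Instance.encode_injective n hJ ▸ hb⟩
    · exact ⟨true, fun I hI => (h ⟨I, hI⟩).elim⟩⟩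

/-- The promise problem `USATₙ`. -/
def USAT (n : ℕ) : PromiseProblem :=
  ofInstances (fun I : Instance n => usatAnswers I.fn) (fun I => by
    by_cases h : Sat (I.first :: I.rest) I.fn
    · exact ⟨true, fun _ => by simp [h]⟩
    · exact ⟨false, fun _ => by simp [h]⟩)

/-- The promise problem `UVALₙ`. -/
def UVAL (n : ℕ) : PromiseProblem :=
  ofInstances (fun I : Instance n => uvalAnswers I.first_pos I.fn) (fun I => by
    by_cases h : ∃! x, x ∈ solutions I.fn
    · obtain ⟨x, hx, -⟩ := h
      exact ⟨_, fun _ => ⟨x, hx, rfl⟩⟩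
    · exact ⟨true, fun h' => (h h').elim⟩)

/-- The class `UΔ̂ₙ₊₁`, as a function of `n`: the weak closure of `USATₙ`. -/
def UDeltaSucc (n : ℕ) : Set PromiseProblem := weakClosure (USAT n)

end PromiseHierarchy

/-!
`UVAL` reduces to `USAT`: restricted to the strings with first letter `1`, the unique solution of
`f` remains exactly if its first letter is `1`.

For the converse, let the *core* of `f` consist of the triples `(t, x, y)` such that either `t = 1`,
`y = 0` and `x` is a solution, or `t = 0` and `y` is the least counterexample to `x`, a value of the
second argument for which the rest of the formula fails. Each `x` is in exactly one such triple. If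
`f` has at most one solution, the condition `t = 1` therefore leaves at most one triple, and
`UVAL` yields the letters of the solution one by one if there is one; to ask for a given letter, put
a new letter `b` in front and equate the two. In the end the core is restricted to the string `x`
that was found, which leaves exactly one triple whether or not the search went well, and `UVAL` is
asked for `t`.

The core is no harder than `f`: that `y` is a counterexample takes one quantifier less than that
there is no smaller one, so two blocks of quantifiers can be interleaved, at the odd and at the even
positions of the same arguments.
-/

namespace PromiseHierarchy

/-! ### Structured programs -/

/-- Structured programs on stacks of bits, the language in which the two reductions are written.
`loop k again p` pops the stack `k` and runs `p o`, where `o` is the letter found, or `none` if the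
stack was empty; it then starts again if `again o` is set. This one construct serves as case
distinction, as bounded iteration and as search for a letter. -/
inductive Prog (K : Type) : Type
  | skip
  | push (k : K) (b : Bool)
  | seq (p q : Prog K)
  | loop (k : K) (again : Option Bool → Bool) (p : Option Bool → Prog K)
  | call

namespace Prog

variable {K : Type}

/-- Total correctness: `p.Must χ qry S t R` says that, whatever the oracle for `χ` answers to
queries on the stack `qry`, the program `p` started in `S` ends after at most `t` steps in a state
that satisfies `R`. -/
inductive Must [DecidableEq K] (χ : PromiseProblem) (qry : K) :
    Prog K → (K → List Bool) → ℕ → ((K → List Bool) → Prop) → Prop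
  | skip {S R} (h : R S) : Must χ qry skip S 1 R
  | push {k b S R} (h : R (Function.update S k (b :: S k))) : Must χ qry (push k b) S 1 R
  | seq {p q S t u R R'} (h : Must χ qry p S t R) (h' : ∀ S', R S' → Must χ qry q S' u R') :
      Must χ qry (seq p q) S (t + u) R'
  | loopExit {k again p S t R} (hk : again (S k).head? = false)
      (h : Must χ qry (p (S k).head?) (Function.update S k (S k).tail) t R) :
      Must χ qry (loop k again p) S (t + 1) R
  | loopRepeat {k again p S t u R R'} (hk : again (S k).head? = true)
      (h : Must χ qry (p (S k).head?) (Function.update S k (S k).tail) t R)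
      (h' : ∀ S', R S' → Must χ qry (loop k again p) S' u R') :
      Must χ qry (loop k again p) S (t + u + 1) R'
  | call {S R} (h : ∀ y ∈ (χ (S qry)).1, R (Function.update S qry [y])) : Must χ qry call S 1 R
  | mono {p S t u R R'} (h : Must χ qry p S t R) (htu : t ≤ u) (hR : ∀ S', R S' → R' S') :
      Must χ qry p S u R'

/-- The labels of the machine code of a program. -/
def Label : Prog K → Type
  | skip => Unit
  | push _ _ => Unit
  | seq p q => p.Label ⊕ q.Label
  | loop _ _ p => Option (Σ o, (p o).Label)
  | call => Unit

/-- The label at which the machine code of a program starts. -/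
def entry : (p : Prog K) → p.Label
  | skip => ()
  | push _ _ => ()
  | seq p _ => Sum.inl p.entry
  | loop _ _ _ => none
  | call => ()

instance finite_label (p : Prog K) : Finite p.Label := by
  induction p with
  | skip | push | call => exact inferInstanceAs (Finite Unit)
  | seq p q _ _ => exact inferInstanceAs (Finite (p.Label ⊕ q.Label))
  | loop _ _ p _ => exact inferInstanceAs (Finite (Option (Σ o, (p o).Label)))

/-- The machine code of a program. The stacks are renamed by `ι` and the labels by `e`, and the
code is left to the label `exit`. The letter that is popped by a loop is kept in the second
component of the internal state. -/
def code {K' L Q : Type} (ι : K → K') : (p : Prog K) → (e : p.Label → L) → (exit : L) → p.Label →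
    Turing.TM2.Stmt (fun _ : K' => Bool) L (Q × Option Bool) ⊕ L
  | skip, _, exit, _ => Sum.inl (.goto fun _ => exit)
  | push k b, _, exit, _ => Sum.inl (.push (ι k) (fun _ => b) (.goto fun _ => exit))
  | seq p q, e, _, Sum.inl x => p.code ι (fun y => e (Sum.inl y)) (e (Sum.inr q.entry)) x
  | seq _ q, e, exit, Sum.inr x => q.code ι (fun y => e (Sum.inr y)) exit x
  | loop k _ p, e, _, none =>
      Sum.inl (.pop (ι k) (fun v o => (v.1, o)) (.goto fun v => e (some ⟨v.2, (p v.2).entry⟩)))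
  | loop _ again p, e, exit, some ⟨o, x⟩ =>
      (p o).code ι (fun y => e (some ⟨o, y⟩)) (bif again o then e none else exit) x
  | call, _, exit, _ => Sum.inr exit

end Prog

/-! ### Bounded termination of oracle machines -/

namespace OracleTM

variable {M : OracleTM} {φ : PromiseProblem} {R R' : M.Cfg → Prop}

/-- Every path of `M` from the configuration passes through `R` after at most `t` steps. -/
inductive Within (M : OracleTM) (φ : PromiseProblem) (R : M.Cfg → Prop) : ℕ → M.Cfg → Prop
  | done {t c} (h : R c) : Within M φ R t c
  | step {t c} (hl : c.l ≠ none) (h : ∀ c', M.Step φ c c' → Within M φ R t c') :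
      Within M φ R (t + 1) c

theorem Within.mono {t u : ℕ} {c : M.Cfg} (h : M.Within φ R t c) (htu : t ≤ u)
    (hR : ∀ c, R c → R' c) : M.Within φ R' u c := by
  induction h generalizing u with
  | done h => exact .done (hR _ h)
  | step hl _ ih =>
    obtain ⟨u, rfl⟩ := Nat.exists_eq_add_one_of_ne_zero (Nat.ne_zero_of_lt htu)
    exact .step hl fun c' hc => ih c' hc (Nat.le_of_succ_le_succ htu)

theorem Within.trans {t u : ℕ} {c : M.Cfg} (h : M.Within φ R t c)
    (h' : ∀ c, R c → M.Within φ R' u c) : M.Within φ R' (t + u) c := by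
  induction h with
  | done h => exact (h' _ h).mono (Nat.le_add_left ..) fun _ => id
  | @step t c hl _ ih => exact Nat.add_right_comm t u 1 ▸ .step hl ih

theorem Within.run {t : ℕ} {l : M.L} {s} (h : M.prog l = Sum.inl s) {v : M.Q}
    {S : M.K → List Bool} (h' : M.Within φ R t (Turing.TM2.stepAux s v S)) :
    M.Within φ R (t + 1) ⟨some l, v, S⟩ := by
  refine .step nofun fun c' hc => ?_
  cases hc with
  | run _ _ hl => cases h.symm.trans hl; exact h'
  | call _ _ _ hl _ => cases h.symm.trans hl

theorem Within.call {t : ℕ} {l l' : M.L} (h : M.prog l = Sum.inr l') {v : M.Q}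
    {S : M.K → List Bool} (h' : ∀ y ∈ (φ (S M.qry)).1,
      M.Within φ R t ⟨some l', v, Function.update S M.qry [y]⟩) :
    M.Within φ R (t + 1) ⟨some l, v, S⟩ := by
  refine .step nofun fun c' hc => ?_
  cases hc with
  | run _ _ hl => cases h.symm.trans hl
  | call _ _ y hl hy => cases h.symm.trans hl; exact h' y hy

theorem Within.of_path {t : ℕ} {c : M.Cfg}
    (h : ∀ k c', M.Path φ k c c' → k ≤ t ∧ (c'.l = none → R c')) :
    M.Within φ (fun c => c.l = none ∧ R c) (t + 1) c := by
  induction t generalizing c with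
  | zero =>
    by_cases hl : c.l = none
    · exact .done ⟨hl, (h 0 c (.refl c)).2 hl⟩
    · exact .step hl fun c' hc => absurd (h 1 c' (.head hc (.refl c'))).1 (by decide)
  | succ t ih =>
    by_cases hl : c.l = none
    · exact .done ⟨hl, (h 0 c (.refl c)).2 hl⟩
    · exact .step hl fun c' hc => ih fun k c'' hp =>
        (h (k + 1) c'' (.head hc hp)).imp_left Nat.le_of_succ_le_succ

theorem Within.path {t : ℕ} {c : M.Cfg} (h : M.Within φ (fun c => c.l = none ∧ R c) t c) {k : ℕ}
    {c' : M.Cfg} (hp : M.Path φ k c c') : k ≤ t ∧ (c'.l = none → R c') := by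
  induction h generalizing k with
  | done h =>
    cases hp with
    | refl => exact ⟨Nat.zero_le _, fun _ => h.2⟩
    | head hc _ => cases hc <;> cases h.1
  | step hl h ih =>
    cases hp with
    | refl => exact ⟨Nat.zero_le _, fun hl' => absurd hl' hl⟩
    | head hc hp => exact (ih _ hc hp).imp_left Nat.succ_le_succ

end OracleTM

theorem turingReducible_iff_within {φ₁ φ₂ : PromiseProblem} :
    TuringReducible φ₁ φ₂ ↔ ∃ (M : OracleTM) (p : Polynomial ℕ), ∀ x : List Bool,
      M.Within φ₂ (fun c => c.l = none ∧ ∃ y ∈ (φ₁ x).1, c.stk M.out = [y]) (p.eval x.length)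
        (M.init x) := by
  constructor
  · rintro ⟨M, p, h⟩
    exact ⟨M, p + 1, fun x => by simpa using OracleTM.Within.of_path (h x)⟩
  · rintro ⟨M, p, h⟩
    exact ⟨M, p, fun x k c hp => (h x).path hp⟩

/-! ### Replacing oracle calls by programs -/

namespace OracleTM

/-- A statement of a machine as a statement of a machine with more stacks, labels and states. -/
def liftStmt {K₁ L₁ Q₁ : Type} (K L : Type) : Turing.TM2.Stmt (fun _ : K₁ => Bool) L₁ Q₁ →
    Turing.TM2.Stmt (fun _ : K₁ ⊕ K => Bool) (L₁ ⊕ L) (Q₁ × Option Bool)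
  | .push k f s => .push (Sum.inl k) (fun v => f v.1) (liftStmt K L s)
  | .peek k f s => .peek (Sum.inl k) (fun v o => (f v.1 o, v.2)) (liftStmt K L s)
  | .pop k f s => .pop (Sum.inl k) (fun v o => (f v.1 o, v.2)) (liftStmt K L s)
  | .load f s => .load (fun v => (f v.1, v.2)) (liftStmt K L s)
  | .branch f s s' => .branch (fun v => f v.1) (liftStmt K L s) (liftStmt K L s')
  | .goto f => .goto fun v => Sum.inl (f v.1)
  | .halt => .halt

/-- A configuration as a configuration of a machine with more stacks, all empty, and with more
labels and states. -/
def liftCfg {K₁ L₁ Q₁ : Type} (K L : Type) (c : Turing.TM2.Cfg (fun _ : K₁ => Bool) L₁ Q₁)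
    (r : Option Bool) :
    Turing.TM2.Cfg (fun _ : K₁ ⊕ K => Bool) (L₁ ⊕ L) (Q₁ × Option Bool) :=
  ⟨c.l.map Sum.inl, (c.var, r), Sum.elim c.stk fun _ => []⟩

theorem stepAux_liftStmt {K₁ L₁ Q₁ K L : Type} [DecidableEq K₁] [DecidableEq K]
    (s : Turing.TM2.Stmt (fun _ : K₁ => Bool) L₁ Q₁) (v : Q₁) (r : Option Bool)
    (S : K₁ → List Bool) :
    Turing.TM2.stepAux (liftStmt K L s) (v, r) (Sum.elim S fun _ => []) =
      liftCfg K L (Turing.TM2.stepAux s v S) r := by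
  induction s generalizing v S with
  | push k f s ih | pop k f s ih =>
    simp only [liftStmt, Turing.TM2.stepAux, Sum.elim_inl]
    rw [← ih, Sum.update_elim_inl]
  | peek k f s ih | load f s ih =>
    simp only [liftStmt, Turing.TM2.stepAux, Sum.elim_inl]
    rw [← ih]
  | branch f s s' ih ih' =>
    simp only [liftStmt, Turing.TM2.stepAux]
    cases f v
    · exact ih' v S
    · exact ih v S
  | goto f => rfl
  | halt => rfl

variable {K₁ K : Type} [DecidableEq K₁] [DecidableEq K]

/-- The place of the stacks of a program that runs inside a machine with the stacks `K₁`: the stack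
`inp` of the program is the stack `q` of the machine. -/
def stackEmb (inp : K) (q : K₁) (k : K) : K₁ ⊕ K := if k = inp then Sum.inl q else Sum.inr k

/-- The contents of all stacks where those of the machine are `S`, except that the stack `q` belongs
to the program, and those of the program are `T`. -/
def graft (inp : K) (q : K₁) (S : K₁ → List Bool) (T : K → List Bool) : K₁ ⊕ K → List Bool :=
  Sum.elim (Function.update S q (T inp)) (Function.update T inp [])

theorem graft_stackEmb (inp : K) (q : K₁) (S : K₁ → List Bool) (T : K → List Bool) (k : K) :
    graft inp q S T (stackEmb inp q k) = T k := by
  by_cases h : k = inp <;> simp only [graft, stackEmb, h, if_true, if_false, Sum.elim_inl,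
    Sum.elim_inr, Function.update_self, ne_eq, not_false_eq_true, Function.update_of_ne]

theorem update_graft (inp : K) (q : K₁) (S : K₁ → List Bool) (T : K → List Bool) (k : K)
    (l : List Bool) : Function.update (graft inp q S T) (stackEmb inp q k) l =
      graft inp q S (Function.update T k l) := by
  by_cases h : k = inp
  · subst h
    simp only [graft, stackEmb, if_true, Sum.update_elim_inl, Function.update_self,
      Function.update_idem]
  · simp only [graft, stackEmb, h, if_false, Sum.update_elim_inr, ne_eq, Ne.symm h,
      not_false_eq_true, Function.update_of_ne, Function.update_comm]

theorem graft_update_nil (inp : K) (q : K₁) (S : K₁ → List Bool) (l : List Bool) :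
    graft inp q S (Function.update (fun _ => []) inp l) =
      Sum.elim (Function.update S q l) fun _ => [] := by
  simp only [graft, Function.update_self, Function.update_idem, Function.update_eq_self]

/-- The machine `M` with its oracle calls replaced by the program `P`, which takes the query from
the stack `inp`, leaves the answer there, and has its own query stack `qry`. -/
noncomputable def inlined [Fintype K] (M : OracleTM) (P : Prog K) (inp qry : K) : OracleTM where
  K := M.K ⊕ K
  inp := Sum.inl M.inp
  qry := stackEmb inp M.qry qry
  out := Sum.inl M.out
  L := M.L ⊕ M.L × P.Label
  finL := Fintype.ofFinite _
  main := Sum.inl M.main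
  Q := M.Q × Option Bool
  start := (M.start, none)
  prog
    | Sum.inl l =>
      match M.prog l with
      | Sum.inl s => Sum.inl (liftStmt K _ s)
      | Sum.inr _ => Sum.inl (.goto fun _ => Sum.inr (l, P.entry))
    | Sum.inr (l, x) =>
      P.code (stackEmb inp M.qry) (fun y => Sum.inr (l, y))
        (match M.prog l with
          | Sum.inl _ => Sum.inl l
          | Sum.inr l' => Sum.inl l') x

variable [Fintype K] {M : OracleTM} {P : Prog K} {inp qry : K} {χ : PromiseProblem}

theorem within_code {p : Prog K} {T : K → List Bool} {t : ℕ} {R : (K → List Bool) → Prop}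
    (hp : p.Must χ qry T t R) (e : p.Label → (M.inlined P inp qry).L)
    (exit : (M.inlined P inp qry).L)
    (he : ∀ x, (M.inlined P inp qry).prog (e x) = p.code (stackEmb inp M.qry) e exit x)
    (v : M.Q × Option Bool) (S : M.K → List Bool) :
    (M.inlined P inp qry).Within χ
      (fun c => ∃ r T', c = ⟨some exit, (v.1, r), graft inp M.qry S T'⟩ ∧ R T') t
      ⟨some (e p.entry), v, graft inp M.qry S T⟩ := by
  have update_graft' (T : K → List Bool) (k : K) (l : List Bool) :
      @Function.update _ _ (M.inlined P inp qry).decEqK (graft inp M.qry S T)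
        (stackEmb inp M.qry k) l = graft inp M.qry S (Function.update T k l) := update_graft ..
  induction hp generalizing exit v with
  | skip h => exact .run (he ()) (.done ⟨v.2, _, rfl, h⟩)
  | push h =>
    refine .run (he ()) (.done ⟨v.2, _, ?_, h⟩)
    simp only [Turing.TM2.stepAux, graft_stackEmb, update_graft']
  | @seq p q T t u R R' _ _ ih ih' =>
    refine (ih (fun y => e (Sum.inl y)) (e (Sum.inr q.entry)) (fun x => he (Sum.inl x)) v).trans ?_
    rintro _ ⟨r, T', rfl, hR⟩
    exact ih' T' hR (fun y => e (Sum.inr y)) exit (fun x => he (Sum.inr x)) (v.1, r)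
  | @loopExit k again p T t R hk _ ih =>
    refine .run (he none) ?_
    simp only [Turing.TM2.stepAux]
    rw [graft_stackEmb, update_graft']
    exact ih (fun y => e (some ⟨_, y⟩)) exit
      (fun x => (he (some ⟨_, x⟩)).trans (by simp only [Prog.code, hk]; rfl))
      (v.1, (T k).head?)
  | @loopRepeat k again p T t u R R' hk _ _ ih ih' =>
    refine .run (he none) ?_
    simp only [Turing.TM2.stepAux]
    rw [graft_stackEmb, update_graft']
    refine (ih (fun y => e (some ⟨_, y⟩)) (e none)
      (fun x => (he (some ⟨_, x⟩)).trans (by simp only [Prog.code, hk]; rfl))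
      (v.1, (T k).head?)).trans ?_
    rintro _ ⟨r, T', rfl, hR⟩
    exact ih' T' hR e exit he (v.1, r)
  | @call T R h =>
    refine .call (he ()) fun y hy => .done ⟨v.2, _, ?_, h y ?_⟩
    · exact congrArg _ (update_graft ..)
    · exact graft_stackEmb inp M.qry S T qry ▸ hy
  | mono _ htu hR ih =>
    refine (ih e exit he v).mono htu ?_
    rintro _ ⟨r, T', rfl, hT'⟩
    exact ⟨r, T', rfl, hR _ hT'⟩

theorem exists_growth_stepAux {L Q : Type} (s : Turing.TM2.Stmt (fun _ : K₁ => Bool) L Q) :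
    ∃ g, ∀ v (S : K₁ → List Bool) k,
      ((Turing.TM2.stepAux s v S).stk k).length ≤ (S k).length + g := by
  induction s with
  | push k f s ih =>
    obtain ⟨g, hg⟩ := ih
    refine ⟨g + 1, fun v S k' => (hg _ _ _).trans ?_⟩
    by_cases h : k' = k
    · subst h; simp; omega
    · rw [Function.update_of_ne h]; omega
  | peek k f s ih | load f s ih => exact ih.imp fun g hg v S k' => hg _ _ _
  | pop k f s ih =>
    obtain ⟨g, hg⟩ := ih
    refine ⟨g, fun v S k' => (hg _ _ _).trans ?_⟩
    by_cases h : k' = k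
    · subst h; simp
    · rw [Function.update_of_ne h]
  | branch f s s' ih ih' =>
    obtain ⟨g, hg⟩ := ih
    obtain ⟨g', hg'⟩ := ih'
    refine ⟨max g g', fun v S k' => ?_⟩
    simp only [Turing.TM2.stepAux]
    cases f v
    · exact (hg' v S k').trans (by simp)
    · exact (hg v S k').trans (by simp)
  | goto f | halt => exact ⟨0, fun v S k => le_rfl⟩

theorem exists_growth (M : OracleTM) : ∃ g, ∀ φ c c', M.Step φ c c' →
    ∀ k, (c'.stk k).length ≤ (c.stk k).length + g := by
  have h (l) : ∃ g, ∀ s, M.prog l = Sum.inl s → ∀ v (S : M.K → List Bool) k,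
      ((Turing.TM2.stepAux s v S).stk k).length ≤ (S k).length + g := by
    cases h : M.prog l with
    | inl s => exact (exists_growth_stepAux s).imp fun g hg s' h' => by cases h'; exact hg
    | inr l' => exact ⟨0, nofun⟩
  choose g hg using h
  refine ⟨∑ l, g l + 1, fun φ c c' hc k => ?_⟩
  cases hc with
  | @run l s v S h =>
    have hl := Finset.single_le_sum (f := g) (fun _ _ => Nat.zero_le _) (Finset.mem_univ l)
    exact (hg l s h v S k).trans (Nat.add_le_add_left (hl.trans (Nat.le_succ _)) _)
  | @call l l' v S y h hy =>
    by_cases hk : k = M.qry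
    · subst hk; simp; omega
    · simp [Function.update_of_ne hk]

theorem within_inlined {ψ : PromiseProblem} {g B T : ℕ}
    (hg : ∀ φ c c', M.Step φ c c' → ∀ k, (c'.stk k).length ≤ (c.stk k).length + g)
    (hP : ∀ q : List Bool, q.length ≤ B → P.Must χ qry (Function.update (fun _ => []) inp q) T
      fun S => ∃ y ∈ (ψ q).1, S = Function.update (fun _ => []) inp [y])
    {R : M.Cfg → Prop} {t : ℕ} {c : M.Cfg} (h : M.Within ψ R t c)
    (hB : ∀ k, (c.stk k).length + t * g ≤ B) (r : Option Bool) :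
    (M.inlined P inp qry).Within χ (fun c' => ∃ c r, c' = liftCfg K _ c r ∧ R c) (t * (T + 1))
      (liftCfg K _ c r) := by
  induction h generalizing r with
  | done h => exact .done ⟨_, r, rfl, h⟩
  | @step t c hl _ ih =>
    have ih {c'} (hc : M.Step ψ c c') := ih c' hc fun k => by
      have := hg _ _ _ hc k
      have := hB k
      rw [Nat.add_one_mul] at this
      omega
    obtain ⟨_ | l, v, S⟩ := c
    · exact absurd rfl hl
    cases hp : M.prog l with
    | inl s =>
      have hs : (M.inlined P inp qry).prog (Sum.inl l) = Sum.inl (liftStmt K _ s) := by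
        simp only [inlined, hp]
      refine (Within.run (t := t * (T + 1)) (v := (v, r)) hs ?_).mono (by grind) fun _ => id
      exact (congrArg _ (stepAux_liftStmt s v r S)).mpr (ih (.run v S hp) r)
    | inr l' =>
      have hs : (M.inlined P inp qry).prog (Sum.inl l) =
          Sum.inl (.goto fun _ => Sum.inr (l, P.entry)) := by simp only [inlined, hp]
      have hq : (S M.qry).length ≤ B := (Nat.le_add_right ..).trans (hB M.qry)
      have hcode := within_code (P := P) (inp := inp) (hP (S M.qry) hq) (fun y => Sum.inr (l, y))
        (Sum.inl l') (fun y => by simp only [inlined, hp]) (v, r) S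
      rw [graft_update_nil, Function.update_eq_self] at hcode
      refine ((Within.run hs hcode).trans (u := t * (T + 1)) ?_).mono (by grind) fun _ => id
      rintro _ ⟨r', _, rfl, y, hy, rfl⟩
      rw [graft_update_nil]
      exact ih (.call v S y hp hy) r'

end OracleTM

/-- The program `P`, started with a query on the stack `inp` and all other stacks empty, replaces
the query by a valid answer of `ψ` in polynomial time, with an oracle for `χ`. -/
def Prog.Computes {K : Type} [DecidableEq K] (P : Prog K) (inp qry : K) (ψ χ : PromiseProblem) :
    Prop :=
  ∃ p : Polynomial ℕ, ∀ q : List Bool,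
    P.Must χ qry (Function.update (fun _ => []) inp q) (p.eval q.length)
      fun S => ∃ y ∈ (ψ q).1, S = Function.update (fun _ => []) inp [y]

theorem polynomial_eval_mono (p : Polynomial ℕ) : Monotone fun n => p.eval n := by
  intro a b h
  simp only [Polynomial.eval_eq_sum_range]
  gcongr

open Polynomial in
theorem TuringReducible.of_computes {K : Type} [DecidableEq K] [Finite K] {P : Prog K}
    {inp qry : K} {φ ψ χ : PromiseProblem} (hP : P.Computes inp qry ψ χ)
    (h : TuringReducible φ ψ) : TuringReducible φ χ := by
  cases nonempty_fintype K
  obtain ⟨M, p₁, hM⟩ := turingReducible_iff_within.1 h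
  obtain ⟨p₂, hP⟩ := hP
  obtain ⟨g, hg⟩ := M.exists_growth
  refine turingReducible_iff_within.2
    ⟨M.inlined P inp qry, p₁ * (p₂.comp (X + p₁ * C g) + 1), fun x => ?_⟩
  have hinit : (M.inlined P inp qry).init x = OracleTM.liftCfg K _ (M.init x) none := by
    refine congrArg (Turing.TM2.Cfg.mk _ _) ?_
    simp only [OracleTM.init, ← Sum.update_elim_inl]
    exact congrArg (fun S => Function.update S _ _) (Sum.elim_lam_const_lam_const _).symm
  have hlength (k) : ((M.init x).stk k).length + p₁.eval x.length * g ≤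
      x.length + p₁.eval x.length * g := by
    by_cases hk : k = M.inp <;> simp [OracleTM.init, hk]
  have hN := OracleTM.within_inlined hg
    (fun q hq => (hP q).mono (polynomial_eval_mono p₂ hq) fun _ => id) (hM x) hlength none
  rw [← hinit] at hN
  refine hN.mono (by simp [eval_comp]) ?_
  rintro _ ⟨c, r, rfl, hl, hc⟩
  exact ⟨by simp only [OracleTM.liftCfg, hl]; rfl, hc⟩

/-! ### Alternating quantification over assignments -/

/-- The universal quantifier if `u` is set, the existential one otherwise. -/
def Quant {α : Type} (u : Bool) (P : α → Prop) : Prop := bif u then ∀ x, P x else ∃ x, P x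

section Quant

variable {α β : Type} {u : Bool} {P Q : α → Prop}

theorem quant_congr (h : ∀ x, P x ↔ Q x) : Quant u P ↔ Quant u Q := by
  rw [funext fun x => propext (h x)]

theorem quant_not : Quant u (fun x => ¬ P x) ↔ ¬ Quant (!u) P := by
  cases u <;> simp [Quant]

theorem quant_const [Nonempty α] {c : Prop} : Quant u (fun _ : α => c) ↔ c := by
  cases u <;> simp [Quant]

theorem quant_and_left [Nonempty α] {c : Prop} : Quant u (fun x => c ∧ P x) ↔ c ∧ Quant u P := by
  cases u <;> simp [Quant, forall_and]

theorem quant_or_left {c : Prop} [Nonempty α] : Quant u (fun x => c ∨ P x) ↔ c ∨ Quant u P := by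
  cases u <;> simp [Quant, forall_or_left, exists_or]

theorem quant_prod [Nonempty α] [Nonempty β] {Q : β → Prop} :
    Quant u (fun x : α × β => P x.1 ∧ Q x.2) ↔ Quant u P ∧ Quant u Q := by
  cases u <;> simp [Quant, forall_and]

theorem quant_comp {f : α → β} (hf : f.Surjective) {Q : β → Prop} :
    Quant u (fun x => Q (f x)) ↔ Quant u Q := by
  cases u
  · exact hf.exists.symm
  · exact hf.forall.symm

end Quant

/-- The string of length `m`, followed by letters `0`. -/
def pad {m : ℕ} (x : Fin m → Bool) : ℕ → Bool := fun j => if h : j < m then x ⟨j, h⟩ else false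

theorem pad_of_lt {m j : ℕ} (x : Fin m → Bool) (h : j < m) : pad x j = x ⟨j, h⟩ := dif_pos h

theorem pad_val {m : ℕ} (x : Fin m → Bool) (j : Fin m) : pad x j = x j := pad_of_lt x j.2

theorem quant_pad {m : ℕ} {u : Bool} {P : (ℕ → Bool) → Prop}
    (hP : ∀ x y : ℕ → Bool, (∀ j < m, x j = y j) → (P x ↔ P y)) :
    Quant u (fun x : Fin m → Bool => P (pad x)) ↔ Quant u P := by
  have hsurj : Function.Surjective fun (x : ℕ → Bool) (j : Fin m) => x j :=
    fun x => ⟨pad x, funext (pad_val x)⟩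
  rw [← quant_comp hsurj]
  exact quant_congr fun x => hP _ _ fun j hj => pad_of_lt _ hj

/-- The truth of `Φ` after `d` alternating quantifiers over the rows `k, k + 1, …` of the assignment
`a`, of which the first is universal if `u` is set. In contrast to `Sat` and `CoSat`, the
quantifiers run over rows of infinite length, so that no lengths have to be kept track of. -/
def Alt : (u : Bool) → (d k : ℕ) → ((ℕ → ℕ → Bool) → Prop) → (ℕ → ℕ → Bool) → Prop
  | _, 0, _, Φ, a => Φ a
  | u, d + 1, k, Φ, a => Quant u fun x : ℕ → Bool => Alt (!u) d (k + 1) Φ (Function.update a k x)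

section Alt

variable {u : Bool} {d k : ℕ} {Φ Ψ : (ℕ → ℕ → Bool) → Prop} {a b : ℕ → ℕ → Bool}

theorem Alt.congr {r : (ℕ → ℕ → Bool) → (ℕ → ℕ → Bool) → Prop}
    (hr : ∀ a b i x, k ≤ i → r a b → r (Function.update a i x) (Function.update b i x))
    (h : ∀ a b, r a b → (Φ a ↔ Ψ b)) (hab : r a b) : Alt u d k Φ a ↔ Alt u d k Ψ b := by
  induction d generalizing u k a b with
  | zero => exact h a b hab
  | succ d ih =>
    exact quant_congr fun x => ih (fun a b i x hi => hr a b i x (Nat.le_of_succ_le hi))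
      (hr a b k x le_rfl hab)

theorem alt_congr_of_row {i : ℕ} (hi : i < k) (h : ∀ b, b i = a i → (Φ b ↔ Ψ b)) :
    Alt u d k Φ a ↔ Alt u d k Ψ a := by
  refine Alt.congr (r := fun b c => b = c ∧ b i = a i) (fun b c j x hj hbc => ?_)
    (fun b c hbc => hbc.1 ▸ h b hbc.2) ⟨rfl, rfl⟩
  rw [hbc.1, Function.update_of_ne (by omega), ← hbc.2, hbc.1]
  exact ⟨rfl, rfl⟩

theorem alt_not : Alt u d k (fun a => ¬ Φ a) a ↔ ¬ Alt (!u) d k Φ a := by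
  induction d generalizing u k a with
  | zero => rfl
  | succ d ih => exact (quant_congr fun x => ih).trans quant_not

theorem alt_and_left {c : Prop} : Alt u d k (fun a => c ∧ Φ a) a ↔ c ∧ Alt u d k Φ a := by
  induction d generalizing u k a with
  | zero => rfl
  | succ d ih => exact (quant_congr fun x => ih).trans quant_and_left

theorem alt_or_left {c : Prop} : Alt u d k (fun a => c ∨ Φ a) a ↔ c ∨ Alt u d k Φ a := by
  induction d generalizing u k a with
  | zero => rfl
  | succ d ih => exact (quant_congr fun x => ih).trans quant_or_left

theorem alt_succ_of_forall_update (h : ∀ a x, Φ (Function.update a (k + d) x) ↔ Φ a) :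
    Alt u (d + 1) k Φ a ↔ Alt u d k Φ a := by
  induction d generalizing u k a with
  | zero => exact (quant_congr fun x => h a x).trans quant_const
  | succ d ih =>
    exact quant_congr fun x => ih fun a x => by rw [← h a x, Nat.add_right_comm k, Nat.add_assoc]

/-- Two independent alternations can be merged into one: the letters of the first one are put at
the even positions, the letters of the second one at the odd positions of the rows. -/
theorem alt_interleave {ρ σ : (ℕ → ℕ → Bool) → ℕ → ℕ → Bool}
    (hρ : ∀ a i x, k ≤ i → ρ (Function.update a i x) = Function.update (ρ a) i fun j => x (2 * j))
    (hσ : ∀ a i x, k ≤ i →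
      σ (Function.update a i x) = Function.update (σ a) (i + 1) fun j => x (2 * j + 1)) :
    Alt u d k (fun a => Φ (ρ a) ∧ Ψ (σ a)) a ↔ Alt u d k Φ (ρ a) ∧ Alt u d (k + 1) Ψ (σ a) := by
  induction d generalizing u k a with
  | zero => rfl
  | succ d ih =>
    have hsplit : Function.Surjective fun x : ℕ → Bool =>
        ((fun j => x (2 * j) : ℕ → Bool), (fun j => x (2 * j + 1) : ℕ → Bool)) := fun ⟨y, z⟩ =>
      ⟨fun j => if j % 2 = 0 then y (j / 2) else z (j / 2), by
        ext j
        · simp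
        · simp [Nat.mul_add_div]⟩
    simp only [Alt]
    rw [← quant_prod, ← quant_comp hsplit]
    refine quant_congr fun x => ?_
    rw [ih (fun a i x hi => hρ a i x (Nat.le_of_succ_le hi))
      fun a i x hi => hσ a i x (Nat.le_of_succ_le hi), hρ _ _ _ le_rfl, hσ _ _ _ le_rfl]

end Alt

/-! ### Expressions -/

namespace Expr

theorem eval_congr {e : Expr} {ms : List ℕ} (he : e.Scoped ms) {a a' : ℕ → ℕ → Bool}
    (h : ∀ i j, j < ms.getD i 0 → a i j = a' i j) : e.eval a = e.eval a' := by
  induction e with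
  | var i j => exact h i j he
  | not e ih => simp only [eval, ih he]
  | and e₁ e₂ ih₁ ih₂ | or e₁ e₂ ih₁ ih₂ => simp only [eval, ih₁ he.1, ih₂ he.2]

/-- Rename the variables of an expression. -/
def rename (σ : ℕ → ℕ → ℕ × ℕ) : Expr → Expr
  | var i j => var (σ i j).1 (σ i j).2
  | not e => not (e.rename σ)
  | and e₁ e₂ => and (e₁.rename σ) (e₂.rename σ)
  | or e₁ e₂ => or (e₁.rename σ) (e₂.rename σ)

theorem eval_rename (σ : ℕ → ℕ → ℕ × ℕ) (e : Expr) (a : ℕ → ℕ → Bool) :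
    (e.rename σ).eval a = e.eval fun i j => a (σ i j).1 (σ i j).2 := by
  induction e <;> simp_all [rename, eval]

theorem Scoped.rename {σ : ℕ → ℕ → ℕ × ℕ} {ms ms' : List ℕ}
    (hσ : ∀ i j, j < ms.getD i 0 → (σ i j).2 < ms'.getD (σ i j).1 0) {e : Expr}
    (he : e.Scoped ms) : (e.rename σ).Scoped ms' := by
  induction e with
  | var i j => exact hσ i j he
  | not e ih => exact ih he
  | and e₁ e₂ ih₁ ih₂ | or e₁ e₂ ih₁ ih₂ => exact ⟨ih₁ he.1, ih₂ he.2⟩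

/-- An expression for the equivalence of two expressions. -/
def iff (e₁ e₂ : Expr) : Expr := or (and e₁ e₂) (and (not e₁) (not e₂))

theorem eval_iff {e₁ e₂ : Expr} {a : ℕ → ℕ → Bool} :
    (e₁.iff e₂).eval a = (e₁.eval a == e₂.eval a) := by
  simp only [iff, eval]
  cases e₁.eval a <;> cases e₂.eval a <;> rfl

variable {e : Expr} {L : List ℕ}

theorem alt_eval_congr (he : e.Scoped L) {u : Bool} {d k : ℕ} {a b : ℕ → ℕ → Bool}
    (h : ∀ i j, j < L.getD i 0 → a i j = b i j) :
    Alt u d k (fun a => e.eval a = true) a ↔ Alt u d k (fun a => e.eval a = true) b := by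
  refine Alt.congr (r := fun a b => ∀ i j, j < L.getD i 0 → a i j = b i j)
    (fun a b i x _ hab i' j hj => ?_) (fun a b hab => by rw [eval_congr he hab]) h
  by_cases hi : i' = i
  · subst hi; simp
  · simp only [Function.update_of_ne hi, hab i' j hj]

theorem sat_toFunFrom_iff_alt (he : e.Scoped L) {ms : List ℕ} {k : ℕ}
    (hms : ∀ i, ms.getD i 0 = L.getD (k + i) 0) (a : ℕ → ℕ → Bool) :
    (Sat ms (e.toFunFrom ms k a) ↔ Alt false ms.length k (fun a => e.eval a = true) a) ∧
      (CoSat ms (e.toFunFrom ms k a) ↔ Alt true ms.length k (fun a => e.eval a = true) a) := by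
  induction ms generalizing k a with
  | nil => exact ⟨Iff.rfl, Iff.rfl⟩
  | cons m ms ih =>
    have ih (x : Fin m → Bool) := ih (k := k + 1) (fun i => by
      rw [← Nat.add_right_comm, Nat.add_assoc, ← hms (i + 1)]; rfl) (Function.update a k (pad x))
    have hpad (u : Bool) : Quant u (fun x : Fin m → Bool =>
          Alt (!u) ms.length (k + 1) (fun a => e.eval a = true) (Function.update a k (pad x))) ↔
        Alt u (ms.length + 1) k (fun a => e.eval a = true) a :=
      quant_pad (P := fun x => Alt (!u) _ _ _ (Function.update a k x)) fun x y hxy =>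
        alt_eval_congr he fun i j hj => by
          by_cases hi : i = k
          · subst hi
            simpa using hxy j (by rwa [← Nat.add_zero i, ← hms 0] at hj)
          · simp only [Function.update_of_ne hi]
    simp only [Sat, CoSat]
    exact ⟨(exists_congr fun x => (ih x).2).trans (hpad false),
      (forall_congr' fun x => (ih x).1).trans (hpad true)⟩

end Expr

/-! ### The core formula -/

/-- The number with the binary digits `y 0, …, y (m - 1)`. -/
def binary (y : ℕ → Bool) : ℕ → ℕ
  | 0 => 0
  | m + 1 => 2 * binary y m + (y m).toNat

theorem binary_inj {y z : ℕ → Bool} {m : ℕ} (h : binary y m = binary z m) :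
    ∀ j < m, y j = z j := by
  induction m with
  | zero => simp
  | succ m ih =>
    simp only [binary] at h
    have h₁ := Bool.toNat_lt (y m)
    have h₂ := Bool.toNat_lt (z m)
    have h₃ : y m = z m := by
      cases hy : y m <;> cases hz : z m <;> simp [hy, hz] at h ⊢ <;> omega
    intro j hj
    rcases Nat.lt_succ_iff_lt_or_eq.1 hj with hj | rfl
    · exact ih (by omega) j hj
    · exact h₃

theorem binary_congr {y z : ℕ → Bool} {m : ℕ} (h : ∀ j < m, y j = z j) :
    binary y m = binary z m := by
  induction m with
  | zero => rfl
  | succ m ih => simp only [binary, ih fun j hj => h j (by omega), h m (by omega)]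

/-- The position of a variable in the formula that makes use of the counterexample `y`: the first
argument now has the letters `b`, `t`, `x`, `y`, and the letters of the later arguments stand at odd
positions of the arguments before them. -/
def oddRenaming (m₁ : ℕ) : ℕ → ℕ → ℕ × ℕ
  | 0, j => (0, 2 + j)
  | 1, j => (0, 2 + m₁ + j)
  | i + 2, j => (i + 1, 2 * j + 1)

/-- The position of a variable in the formula that quantifies over all strings: the letters of the
later arguments stand at even positions. -/
def evenRenaming : ℕ → ℕ → ℕ × ℕ
  | 0, j => (0, 2 + j)
  | i + 1, j => (i + 1, 2 * j)

namespace Expr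

/-- `geIter m₁ m e` says that the string `z` at the even positions of the second argument is greater
than `y` in the lexicographic order, or it is equal to `y` and `e` holds. -/
def geIter (m₁ : ℕ) : ℕ → Expr → Expr
  | 0, e => e
  | m + 1, e => geIter m₁ m
      (or (and (var 1 (2 * m)) (not (var 0 (2 + m₁ + m))))
        (and (or (var 1 (2 * m)) (not (var 0 (2 + m₁ + m)))) e))

/-- `zeroIter m₁ m e` says that `e` holds and that `y` is zero if `t` is set. -/
def zeroIter (m₁ : ℕ) : ℕ → Expr → Expr
  | 0, e => e
  | m + 1, e => zeroIter m₁ m (and (or (not (var 0 1)) (not (var 0 (2 + m₁ + m)))) e)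

/-- The formula that, for each `x`, has exactly one solution `(t, y)`: if `f` is accepted at
`x` then `t = 1` and `y = 0`, otherwise `t = 0` and `y` is the least counterexample. -/
def core (m₁ m₂ : ℕ) (f : Expr) : Expr :=
  zeroIter m₁ m₂ (and
    (or (and (not (var 0 1)) (geIter m₁ m₂ (not (var 0 1)))) (f.rename evenRenaming))
    (or (var 0 1) (not (f.rename (oddRenaming m₁)))))

theorem eval_geIter (m₁ m : ℕ) (e : Expr) (a : ℕ → ℕ → Bool) :
    (geIter m₁ m e).eval a = true ↔
      binary (fun j => a 0 (2 + m₁ + j)) m < binary (fun j => a 1 (2 * j)) m ∨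
        binary (fun j => a 0 (2 + m₁ + j)) m = binary (fun j => a 1 (2 * j)) m ∧
          e.eval a = true := by
  induction m generalizing e with
  | zero => simp [geIter, binary]
  | succ m ih =>
    rw [geIter, ih]
    simp only [eval, binary]
    cases a 0 (2 + m₁ + m) <;> cases a 1 (2 * m) <;> cases e.eval a <;> simp <;> omega

theorem eval_zeroIter (m₁ m : ℕ) (e : Expr) (a : ℕ → ℕ → Bool) :
    (zeroIter m₁ m e).eval a = true ↔
      (a 0 1 = true → ∀ j < m, a 0 (2 + m₁ + j) = false) ∧ e.eval a = true := by
  induction m generalizing e with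
  | zero => simp [zeroIter]
  | succ m ih =>
    rw [zeroIter, ih]
    simp only [eval, Nat.forall_lt_succ_right]
    cases a 0 1 <;> cases a 0 (2 + m₁ + m) <;> cases e.eval a <;> simp

theorem eval_core (m₁ m₂ : ℕ) (f : Expr) (a : ℕ → ℕ → Bool) :
    (core m₁ m₂ f).eval a = true ↔
      (a 0 1 = true → ∀ j < m₂, a 0 (2 + m₁ + j) = false) ∧
        (a 0 1 = true ∨ ¬ (f.rename (oddRenaming m₁)).eval a = true) ∧
          ((a 0 1 = false ∧
            binary (fun j => a 0 (2 + m₁ + j)) m₂ ≤ binary (fun j => a 1 (2 * j)) m₂) ∨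
              (f.rename evenRenaming).eval a = true) := by
  rw [core, eval_zeroIter, le_iff_lt_or_eq]
  simp only [eval, Bool.and_eq_true, Bool.or_eq_true, Bool.not_eq_true', eval_geIter,
    Bool.not_eq_true]
  tauto

theorem Scoped.geIter {m₁ m : ℕ} {e : Expr} {ms : List ℕ} (h₁ : 2 + m₁ + m ≤ ms.getD 0 0)
    (h₂ : 2 * m ≤ ms.getD 1 0) (he : e.Scoped ms) : (e.geIter m₁ m).Scoped ms := by
  induction m generalizing e with
  | zero => exact he
  | succ m ih =>
    refine ih (by omega) (by omega) ?_
    simp only [Scoped]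
    refine ⟨⟨?_, ?_⟩, ⟨?_, ?_⟩, he⟩ <;> omega

theorem Scoped.zeroIter {m₁ m : ℕ} {e : Expr} {ms : List ℕ} (h₁ : 2 + m₁ + m ≤ ms.getD 0 0)
    (he : e.Scoped ms) : (e.zeroIter m₁ m).Scoped ms := by
  induction m generalizing e with
  | zero => exact he
  | succ m ih =>
    refine ih (by omega) ?_
    simp only [Scoped]
    refine ⟨⟨?_, ?_⟩, he⟩ <;> omega

end Expr

theorem getD_le_sum (l : List ℕ) (i : ℕ) : l.getD i 0 ≤ l.sum := by
  by_cases h : i < l.length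
  · rw [List.getD_eq_getElem _ _ h]
    exact List.le_sum_of_mem (List.getElem_mem h)
  · rw [List.getD_eq_default _ _ (not_lt.1 h)]
    exact Nat.zero_le _

/-- The lengths of the arguments of the new formula. -/
def liftLengths (m₁ : ℕ) (rest : List ℕ) : List ℕ :=
  (2 + m₁ + rest.headD 0) :: List.replicate rest.length (2 * rest.sum)

theorem liftLengths_getD_succ {m₁ : ℕ} {rest : List ℕ} {i i' j : ℕ} (hi : i ≤ i')
    (h : j < rest.getD i' 0) : 2 * j + 1 < (liftLengths m₁ rest).getD (i + 1) 0 := by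
  have hi : i < rest.length := by
    by_contra hi
    rw [List.getD_eq_default _ _ (by omega)] at h
    omega
  have := getD_le_sum rest i'
  rw [liftLengths, List.getD_cons_succ, List.getD_eq_getElem _ _ (by simpa using hi)]
  simp only [List.getElem_replicate]
  omega

theorem Expr.Scoped.core {m₁ : ℕ} {rest : List ℕ} {f : Expr} (hf : f.Scoped (m₁ :: rest)) :
    (f.core m₁ (rest.headD 0)).Scoped (liftLengths m₁ rest) := by
  have h₀ : (liftLengths m₁ rest).getD 0 0 = 2 + m₁ + rest.headD 0 := rfl
  have ht : (var 0 1).Scoped (liftLengths m₁ rest) := by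
    simp only [Scoped, h₀]
    omega
  refine .zeroIter h₀.ge ⟨⟨⟨ht, .geIter h₀.ge ?_ ht⟩, ?_⟩, ht, ?_⟩
  · cases rest with
    | nil => simp
    | cons m ms => simp [liftLengths, List.replicate_succ]
  · refine hf.rename fun i j hj => ?_
    cases i with
    | zero =>
      simp only [evenRenaming, h₀]
      simp only [List.getD_cons_zero] at hj
      omega
    | succ i =>
      have := liftLengths_getD_succ (m₁ := m₁) le_rfl (by rwa [List.getD_cons_succ] at hj)
      simp only [evenRenaming]
      omega
  · refine hf.rename fun i j hj => ?_
    match i with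
    | 0 =>
      simp only [oddRenaming, h₀]
      simp only [List.getD_cons_zero] at hj
      omega
    | 1 =>
      simp only [oddRenaming, h₀]
      cases rest with
      | nil => simp at hj
      | cons m ms => simp at hj ⊢; omega
    | i + 2 =>
      simp only [oddRenaming]
      exact liftLengths_getD_succ (Nat.le_succ i) (by rwa [List.getD_cons_succ] at hj)

/-- The conditions that `core` imposes on `(t, y)` at a fixed `x`, where `D` is the set of the
strings that are not counterexamples. -/
def ValidPair {m : ℕ} (D : (Fin m → Bool) → Prop) (t : Bool) (y : Fin m → Bool) : Prop :=
  (t = true → ∀ j, y j = false) ∧ (t = true ∨ ¬ D y) ∧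
    ∀ z : Fin m → Bool, (t = false ∧ binary (pad y) m ≤ binary (pad z) m) ∨ D z

section ValidPair

variable {m : ℕ} {D : (Fin m → Bool) → Prop}

theorem validPair_iff_of_forall (hD : ∀ y, D y) {t : Bool} {y : Fin m → Bool} :
    ValidPair D t y ↔ t = true ∧ y = fun _ => false := by
  constructor
  · rintro ⟨hzero, hneg, -⟩
    have ht := hneg.resolve_right (not_not.2 (hD y))
    exact ⟨ht, funext (hzero ht)⟩
  · rintro ⟨rfl, rfl⟩
    exact ⟨fun _ _ => rfl, .inl rfl, fun z => .inr (hD z)⟩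

theorem validPair_iff_of_isLeast {y₀ : Fin m → Bool} (hy₀ : ¬ D y₀)
    (hmin : ∀ z, ¬ D z → binary (pad y₀) m ≤ binary (pad z) m) {t : Bool} {y : Fin m → Bool} :
    ValidPair D t y ↔ t = false ∧ y = y₀ := by
  constructor
  · rintro ⟨-, hneg, hle⟩
    obtain ⟨rfl, hle₀⟩ := (hle y₀).resolve_right hy₀
    refine ⟨rfl, funext fun j => ?_⟩
    have hge := hmin y (hneg.resolve_left Bool.false_ne_true)
    simpa only [pad_val] using binary_inj (le_antisymm hle₀ hge) j j.2
  · rintro ⟨rfl, rfl⟩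
    exact ⟨nofun, .inr hy₀, fun z => or_iff_not_imp_right.2 fun hz => ⟨rfl, hmin z hz⟩⟩

theorem exists_validPair_iff (D : (Fin m → Bool) → Prop) :
    ∃ t₀ y₀, (t₀ = true ↔ ∀ y, D y) ∧ ∀ t y, ValidPair D t y ↔ t = t₀ ∧ y = y₀ := by
  by_cases hD : ∀ y, D y
  · exact ⟨true, _, iff_of_true rfl hD, fun _ _ => validPair_iff_of_forall hD⟩
  · obtain ⟨y₀, hy₀, hmin⟩ := exists_minimalFor_of_wellFoundedLT (fun y => ¬ D y)
      (fun y => binary (pad y) m) (not_forall.1 hD)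
    exact ⟨false, y₀, iff_of_false Bool.false_ne_true hD, fun _ _ =>
      validPair_iff_of_isLeast hy₀ fun z hz => le_of_not_gt fun h => h.not_ge (hmin hz h.le)⟩

end ValidPair

namespace Instance

variable {n : ℕ} (I : Instance n)

/-- The length of the second argument, or zero if there is only one argument. -/
abbrev second : ℕ := I.rest.headD 0

theorem getD_one : (I.first :: I.rest).getD 1 0 = I.second := List.headD_eq_getD.symm

/-- The assignment that gives the letters of `x` to the first argument. -/
def assign {m : ℕ} (x : Fin m → Bool) : ℕ → ℕ → Bool :=
  Function.update (fun _ _ => false) 0 (pad x)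

/-- The string `y` is no counterexample for `x`. The number of quantifiers exceeds the number of the
remaining arguments by one, which makes no difference and avoids a special case for `n = 1`. -/
def Passes (x : Fin I.first → Bool) (y : Fin I.second → Bool) : Prop :=
  Alt false I.rest.length 2 (fun a => I.expr.eval a = true)
    (Function.update (assign x) 1 (pad y))

theorem mem_solutions_iff_alt (x : Fin I.first → Bool) : x ∈ solutions I.fn ↔
    Alt true I.rest.length 1 (fun a => I.expr.eval a = true) (assign x) :=
  (Expr.sat_toFunFrom_iff_alt I.expr_scoped (fun i => by
    rw [Nat.add_comm, List.getD_cons_succ]) (assign x)).2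

theorem alt_succ_length {R : (ℕ → Bool) → Prop}
    (hR : ∀ y z : ℕ → Bool, (∀ j < I.second, y j = z j) → (R y ↔ R z)) {u : Bool}
    {a : ℕ → ℕ → Bool} :
    Alt u (I.rest.length + 1) 1 (fun a => R (a 1) ∨ I.expr.eval a = true) a ↔
      Alt u I.rest.length 1 (fun a => R (a 1) ∨ I.expr.eval a = true) a := by
  refine alt_succ_of_forall_update fun a y => ?_
  have hrow (i j : ℕ) (hj : j < (I.first :: I.rest).getD i 0) :
      Function.update a (1 + I.rest.length) y i j = a i j := by
    rw [Function.update_of_ne]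
    rintro rfl
    simp [Nat.add_comm 1] at hj
  rw [Expr.eval_congr I.expr_scoped hrow, hR _ _ fun j hj => hrow 1 j (I.getD_one ▸ hj)]

theorem alt_or_iff_forall_passes {R : (ℕ → Bool) → Prop}
    (hR : ∀ y z : ℕ → Bool, (∀ j < I.second, y j = z j) → (R y ↔ R z))
    {x : Fin I.first → Bool} {a : ℕ → ℕ → Bool}
    (ha : ∀ i j, j < (I.first :: I.rest).getD i 0 → a i j = assign x i j) :
    Alt true I.rest.length 1 (fun a => R (a 1) ∨ I.expr.eval a = true) a ↔
      ∀ z, R (pad z) ∨ I.Passes x z := by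
  have hpasses (y z : ℕ → Bool) (hyz : ∀ j < I.second, y j = z j) :
      Alt false I.rest.length 2 (fun a => I.expr.eval a = true) (Function.update a 1 y) ↔
        Alt false I.rest.length 2 (fun a => I.expr.eval a = true)
          (Function.update (assign x) 1 z) := by
    refine Expr.alt_eval_congr I.expr_scoped fun i j hj => ?_
    by_cases hi : i = 1
    · subst hi
      simpa only [Function.update_self] using hyz j (I.getD_one ▸ hj)
    · simpa only [Function.update_of_ne hi] using ha i j hj
  rw [← I.alt_succ_length hR]
  have hpad := quant_pad (u := true) (P := fun y => R y ∨ Alt false I.rest.length 2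
    (fun a => I.expr.eval a = true) (Function.update a 1 y)) fun y z hyz =>
      or_congr (hR y z hyz) ((hpasses y z hyz).trans (hpasses z z fun _ _ => rfl).symm)
  refine Iff.trans (quant_congr fun y => ?_) (hpad.symm.trans (quant_congr fun z =>
    or_congr_right (hpasses _ _ fun _ _ => rfl)))
  rw [← alt_or_left]
  exact alt_congr_of_row one_lt_two fun b hb => by rw [hb, Function.update_self]

theorem mem_solutions_iff_passes (x : Fin I.first → Bool) :
    x ∈ solutions I.fn ↔ ∀ y, I.Passes x y := by
  simpa only [false_or, ← mem_solutions_iff_alt] using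
    I.alt_or_iff_forall_passes (R := fun _ => False) (fun _ _ _ => Iff.rfl)
      (x := x) fun _ _ _ => rfl

/-- The instance with an expression over the lengthened arguments. -/
def lift (E : Expr) (hE : E.Scoped (liftLengths I.first I.rest)) : Instance n where
  first := 2 + I.first + I.second
  rest := List.replicate I.rest.length (2 * I.rest.sum)
  expr := E
  first_pos := by omega
  level := by simpa using I.level
  expr_scoped := hE

/-- The letters of the first argument that stand for `x`. -/
def xPart (v : Fin (2 + I.first + I.second) → Bool) : Fin I.first → Bool :=
  fun j => pad v (2 + j)

/-- The letters of the first argument that stand for `y`. -/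
def yPart (v : Fin (2 + I.first + I.second) → Bool) : Fin I.second → Bool :=
  fun j => pad v (2 + I.first + j)

theorem pad_xPart (v : Fin (2 + I.first + I.second) → Bool) {j : ℕ} (hj : j < I.first) :
    pad (I.xPart v) j = pad v (2 + j) := pad_of_lt _ hj

theorem pad_yPart (v : Fin (2 + I.first + I.second) → Bool) {j : ℕ} (hj : j < I.second) :
    pad (I.yPart v) j = pad v (2 + I.first + j) := pad_of_lt _ hj

/-- The first argument with the parts `b`, `t`, `x` and `y`. -/
def glue (b t : Bool) (x : Fin I.first → Bool) (y : Fin I.second → Bool) :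
    Fin (2 + I.first + I.second) → Bool := fun i =>
  if i.1 = 0 then b else if i.1 = 1 then t else
    if i.1 < 2 + I.first then pad x (i - 2) else pad y (i - (2 + I.first))

theorem glue_parts (b t : Bool) (x : Fin I.first → Bool) (y : Fin I.second → Bool) :
    pad (I.glue b t x y) 0 = b ∧ pad (I.glue b t x y) 1 = t ∧
      I.xPart (I.glue b t x y) = x ∧ I.yPart (I.glue b t x y) = y := by
  refine ⟨?_, ?_, funext fun j => ?_, funext fun j => ?_⟩
  · rw [pad_of_lt _ (by omega)]; simp [glue]
  · rw [pad_of_lt _ (by omega)]; simp [glue]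
  · have := j.2
    rw [xPart, pad_of_lt _ (by omega)]
    simp [glue, pad_val, show 2 + j.1 ≠ 1 by omega]
  · have := j.2
    rw [yPart, pad_of_lt _ (by omega)]
    simp [glue, pad_val, show 2 + I.first + j.1 ≠ 1 by omega]

theorem glue_eta (v : Fin (2 + I.first + I.second) → Bool) :
    v = I.glue (pad v 0) (pad v 1) (I.xPart v) (I.yPart v) := by
  funext i
  rw [glue]
  have := i.2
  split_ifs with h₀ h₁ h₂
  · rw [← h₀, pad_val]
  · rw [← h₁, pad_val]
  · rw [pad_xPart _ _ (by omega), show 2 + (i.1 - 2) = i.1 by omega, pad_val]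
  · rw [pad_yPart _ _ (by omega), show 2 + I.first + (i.1 - (2 + I.first)) = i.1 by omega, pad_val]

/-- The rows that `evenRenaming` selects. -/
def evenRows (a : ℕ → ℕ → Bool) : ℕ → ℕ → Bool :=
  fun i j => a (evenRenaming i j).1 (evenRenaming i j).2

/-- The rows that `oddRenaming` selects. -/
def oddRows (a : ℕ → ℕ → Bool) : ℕ → ℕ → Bool :=
  fun i j => a (oddRenaming I.first i j).1 (oddRenaming I.first i j).2

theorem evenRows_update {a : ℕ → ℕ → Bool} {i : ℕ} {x : ℕ → Bool} (hi : 1 ≤ i) :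
    evenRows (Function.update a i x) = Function.update (evenRows a) i fun j => x (2 * j) := by
  funext i' j
  by_cases h : i' = i
  · obtain ⟨i, rfl⟩ := Nat.exists_eq_add_of_le' hi
    subst h
    simp [evenRows, evenRenaming]
  · rcases i' with - | i' <;>
      simp [evenRows, evenRenaming, Function.update_of_ne h]

theorem oddRows_update {a : ℕ → ℕ → Bool} {i : ℕ} {x : ℕ → Bool} (hi : 1 ≤ i) :
    I.oddRows (Function.update a i x) =
      Function.update (I.oddRows a) (i + 1) fun j => x (2 * j + 1) := by
  funext i' j
  obtain ⟨i, rfl⟩ := Nat.exists_eq_add_of_le' hi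
  by_cases h : i' = i + 1 + 1
  · subst h
    simp [oddRows, oddRenaming]
  · rw [Function.update_of_ne h]
    rcases i' with - | - | i' <;>
      simp_all [oddRows, oddRenaming]

variable (v : Fin (2 + I.first + I.second) → Bool)

theorem alt_evenRows {R : (ℕ → Bool) → Prop}
    (hR : ∀ y z : ℕ → Bool, (∀ j < I.second, y j = z j) → (R y ↔ R z)) :
    Alt true I.rest.length 1 (fun a => R (a 1) ∨ I.expr.eval a = true) (evenRows (assign v)) ↔
      ∀ z, R (pad z) ∨ I.Passes (I.xPart v) z := by
  refine I.alt_or_iff_forall_passes hR fun i j hj => ?_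
  match i with
  | 0 => exact (I.pad_xPart v hj).symm
  | i + 1 => rfl

theorem alt_oddRows :
    Alt false I.rest.length 2 (fun a => I.expr.eval a = true) (I.oddRows (assign v)) ↔
      I.Passes (I.xPart v) (I.yPart v) := by
  refine Expr.alt_eval_congr I.expr_scoped fun i j hj => ?_
  match i with
  | 0 => exact (I.pad_xPart v hj).symm
  | 1 => exact (I.pad_yPart v (I.getD_one ▸ hj)).symm
  | i + 2 => rfl

theorem eval_core_iff {a : ℕ → ℕ → Bool} (ha : a 0 = pad v) :
    (I.expr.core I.first I.second).eval a = true ↔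
      (pad v 1 = true → ∀ j, I.yPart v j = false) ∧
        ((pad v 1 = false ∧
            binary (pad (I.yPart v)) I.second ≤ binary (evenRows a 1) I.second) ∨
          I.expr.eval (evenRows a) = true) ∧
        (pad v 1 = true ∨ ¬ I.expr.eval (I.oddRows a) = true) := by
  have hy : binary (fun j => pad v (2 + I.first + j)) I.second =
      binary (pad (I.yPart v)) I.second := binary_congr fun j hj => (I.pad_yPart v hj).symm
  have hzero : (∀ j < I.second, pad v (2 + I.first + j) = false) ↔ ∀ j, I.yPart v j = false :=
    ⟨fun h j => h j j.2, fun h j hj => h ⟨j, hj⟩⟩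
  rw [Expr.eval_core, ha, hy, hzero, Expr.eval_rename, Expr.eval_rename]
  exact and_congr_right fun _ => and_comm

theorem mem_solutions_lift {E : Expr} (hE : E.Scoped (liftLengths I.first I.rest))
    {P : (ℕ → Bool) → Prop} (hP : ∀ a, E.eval a = true ↔
      P (a 0) ∧ (I.expr.core I.first I.second).eval a = true) :
    v ∈ solutions (I.lift E hE).fn ↔
      P (pad v) ∧ ValidPair (I.Passes (I.xPart v)) (pad v 1) (I.yPart v) := by
  let y := I.yPart v
  let C (z : ℕ → Bool) : Prop := pad v 1 = false ∧ binary (pad y) I.second ≤ binary z I.second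
  have hC (z z' : ℕ → Bool) (h : ∀ j < I.second, z j = z' j) : C z ↔ C z' := by
    simp only [C, binary_congr h]
  have hE_eval (a : ℕ → ℕ → Bool) (ha : a 0 = pad v) : E.eval a = true ↔
      (P (pad v) ∧ (pad v 1 = true → ∀ j, y j = false)) ∧
        (C (evenRows a 1) ∨ I.expr.eval (evenRows a) = true) ∧
          (pad v 1 = true ∨ ¬ I.expr.eval (I.oddRows a) = true) := by
    rw [hP, ha, I.eval_core_iff v ha, and_assoc]
  have hAlt : Alt true I.rest.length 1 (fun a => E.eval a = true) (assign v) ↔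
      P (pad v) ∧ ValidPair (I.Passes (I.xPart v)) (pad v 1) y := by
    rw [alt_congr_of_row one_pos hE_eval, alt_and_left,
      alt_interleave (Φ := fun a => C (a 1) ∨ I.expr.eval a = true)
        (Ψ := fun a => pad v 1 = true ∨ ¬ I.expr.eval a = true)
        (fun a i x => evenRows_update) (fun a i x => I.oddRows_update),
      I.alt_evenRows v hC, alt_or_left, alt_not, Bool.not_true, I.alt_oddRows v, and_assoc]
    exact and_congr_right fun _ => and_congr_right fun _ => and_comm
  rw [← hAlt]
  refine ((I.lift E hE).mem_solutions_iff_alt v).trans ?_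
  change Alt true (List.replicate I.rest.length _).length 1 (fun a => E.eval a = true) _ ↔ _
  rw [List.length_replicate]
  rfl

end Instance

/-! ### The search for the solution -/

namespace Expr

/-- The formula that says that `t` is set and that `b` is the letter `j` of `x`. -/
def searchTest (j : ℕ) : Expr := and (var 0 1) (iff (var 0 0) (var 0 (2 + j)))

/-- The formula that says that `b` and `t` are equal. -/
def finalTest : Expr := iff (var 0 0) (var 0 1)

/-- The literal that says that the letter `j` of `x` is `y`. -/
def literal (j : ℕ) : Bool → Expr
  | true => var 0 (2 + j)
  | false => not (var 0 (2 + j))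

theorem eval_literal {j : ℕ} {y : Bool} {a : ℕ → ℕ → Bool} :
    (literal j y).eval a = true ↔ a 0 (2 + j) = y := by
  cases y <;> simp [literal, eval]

end Expr

namespace Instance

variable {n : ℕ} (I : Instance n)

/-- `G` restricts the formula `core` to the strings `x` that agree with `c` from position `i` on,
where `c` agrees with the solution if it is unique. -/
structure IsPartial (c : ℕ → Bool) (i : ℕ) (G : Expr) : Prop where
  scope : G.Scoped (liftLengths I.first I.rest)
  eval_iff : ∀ a, G.eval a = true ↔ (∀ j < I.first, i ≤ j → a 0 (2 + j) = c j) ∧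
    (I.expr.core I.first I.second).eval a = true
  agrees : (solutions I.fn).encard ≤ 1 → ∀ x ∈ solutions I.fn, ∀ j < I.first, i ≤ j → c j = pad x j

variable {I}

theorem scoped_var {j : ℕ} (h : j < 2 + I.first) :
    (Expr.var 0 j).Scoped (liftLengths I.first I.rest) := by
  simp only [Expr.Scoped, liftLengths, List.getD_cons_zero]
  omega

theorem isPartial_core : I.IsPartial (fun _ => false) I.first (I.expr.core I.first I.second) where
  scope := I.expr_scoped.core
  eval_iff a := ⟨fun h => ⟨fun j h₁ h₂ => by omega, h⟩, And.right⟩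
  agrees _ x _ j h₁ h₂ := by omega

theorem eq_of_mem_UVAL_lift {E : Expr} {hE : E.Scoped (liftLengths I.first I.rest)}
    {P : (ℕ → Bool) → Prop}
    (hP : ∀ a, E.eval a = true ↔ P (a 0) ∧ (I.expr.core I.first I.second).eval a = true)
    {b t : Bool} {x : Fin I.first → Bool} {y : Fin I.second → Bool}
    (hx : ∀ t' y', ValidPair (I.Passes x) t' y' ↔ t' = t ∧ y' = y)
    (hglue : P (pad (I.glue b t x y)))
    (hunique : ∀ v : Fin (2 + I.first + I.second) → Bool, P (pad v) →
      ValidPair (I.Passes (I.xPart v)) (pad v 1) (I.yPart v) →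
        I.xPart v = x ∧ (pad v 1 = t → pad v 0 = b))
    {c : Bool} (hc : c ∈ (UVAL n (I.lift E hE).encode).1) : c = b := by
  have hmem (v : Fin (2 + I.first + I.second) → Bool) :
      v ∈ solutions (I.lift E hE).fn ↔ v = I.glue b t x y := by
    rw [I.mem_solutions_lift v hE hP]
    constructor
    · rintro ⟨hv, hvalid⟩
      obtain ⟨rfl, hb⟩ := hunique v hv hvalid
      obtain ⟨ht, rfl⟩ := (hx _ _).1 hvalid
      rw [← hb ht, ← ht]
      exact I.glue_eta v
    · rintro rfl
      obtain ⟨-, ht, hx', hy⟩ := I.glue_parts b t x y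
      exact ⟨hglue, by rw [ht, hx', hy, hx]; exact ⟨rfl, rfl⟩⟩
  obtain ⟨v, hv, rfl⟩ := hc (I.lift E hE) rfl ⟨_, (hmem _).2 rfl, fun w hw => (hmem w).1 hw⟩
  have hfirst := (I.glue_parts b t x y).1
  rw [pad_of_lt _ (by omega)] at hfirst
  exact (congrFun ((hmem v).1 hv) _).trans hfirst

namespace IsPartial

variable {c : ℕ → Bool} {i : ℕ} {G : Expr} {y : Bool}

theorem scoped_and_searchTest (h : I.IsPartial c i G) {j : ℕ} (hj : j < I.first) :
    (Expr.and (.searchTest j) G).Scoped (liftLengths I.first I.rest) := by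
  have h₀ : (Expr.var 0 0).Scoped (liftLengths I.first I.rest) := scoped_var (by omega)
  have h₁ : (Expr.var 0 (2 + j)).Scoped (liftLengths I.first I.rest) := scoped_var (by omega)
  exact ⟨⟨scoped_var (by omega), ⟨h₀, h₁⟩, h₀, h₁⟩, h.scope⟩

theorem scoped_and_finalTest (h : I.IsPartial c i G) :
    (Expr.and .finalTest G).Scoped (liftLengths I.first I.rest) := by
  have h₀ : (Expr.var 0 0).Scoped (liftLengths I.first I.rest) := scoped_var (by omega)
  have h₁ : (Expr.var 0 1).Scoped (liftLengths I.first I.rest) := scoped_var (by omega)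
  exact ⟨⟨⟨h₀, h₁⟩, h₀, h₁⟩, h.scope⟩

theorem eq_of_mem_UVAL_searchTest (h : I.IsPartial c (i + 1) G) (hi : i < I.first)
    (hle : (solutions I.fn).encard ≤ 1) {x : Fin I.first → Bool} (hx : x ∈ solutions I.fn)
    (hy : y ∈ (UVAL n (I.lift _ (h.scoped_and_searchTest hi)).encode).1) : y = pad x i := by
  obtain ⟨t, z, ht, hvalid⟩ := exists_validPair_iff (I.Passes x)
  obtain rfl : t = true := ht.2 ((I.mem_solutions_iff_passes x).1 hx)
  refine eq_of_mem_UVAL_lift (P := fun α => (α 1 = true ∧ α 0 = α (2 + i)) ∧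
    ∀ j < I.first, i + 1 ≤ j → α (2 + j) = c j) (fun a => ?_) hvalid ?_ (fun v hv hpair => ?_) hy
  · simp only [Expr.eval, Expr.searchTest, Bool.and_eq_true, h.eval_iff, Expr.eval_iff,
      beq_iff_eq, and_assoc]
  · obtain ⟨hb, ht', hx', -⟩ := I.glue_parts (pad x i) true x z
    refine ⟨⟨ht', ?_⟩, fun j hj hij => ?_⟩
    · rw [hb, ← I.pad_xPart _ hi, hx']
    · rw [← I.pad_xPart _ hj, hx', h.agrees hle x hx j hj hij]
  · have hpasses : I.xPart v ∈ solutions I.fn := by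
      obtain ⟨t', z', ht', hvalid'⟩ := exists_validPair_iff (I.Passes (I.xPart v))
      rw [I.mem_solutions_iff_passes, ← ht', ← ((hvalid' _ _).1 hpair).1, hv.1.1]
    have hxv : I.xPart v = x := Set.encard_le_one_iff.1 hle _ _ hpasses hx
    exact ⟨hxv, fun _ => by rw [hv.1.2, ← I.pad_xPart v hi, hxv]⟩

theorem literal (h : I.IsPartial c (i + 1) G) (hi : i < I.first)
    (hy : y ∈ (UVAL n (I.lift _ (h.scoped_and_searchTest hi)).encode).1) :
    I.IsPartial (Function.update c i y) i (.and (.literal i y) G) where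
  scope := by
    refine ⟨?_, h.scope⟩
    cases y <;> exact scoped_var (by omega)
  eval_iff a := by
    rw [Expr.eval, Bool.and_eq_true, Expr.eval_literal, h.eval_iff, ← and_assoc]
    refine and_congr_left' ⟨fun ⟨h₁, h₂⟩ j hj hij => ?_, fun h₁ => ⟨?_, fun j hj hij => ?_⟩⟩
    · rcases eq_or_lt_of_le hij with rfl | hij
      · rw [h₁, Function.update_self]
      · rw [Function.update_of_ne (by omega), h₂ j hj hij]
    · rw [h₁ i hi le_rfl, Function.update_self]
    · rw [h₁ j hj (by omega), Function.update_of_ne (by omega)]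
  agrees hle x hx j hj hij := by
    rcases eq_or_lt_of_le hij with rfl | hij
    · rw [Function.update_self, h.eq_of_mem_UVAL_searchTest hi hle hx hy]
    · rw [Function.update_of_ne (by omega)]
      exact h.agrees hle x hx j hj hij

theorem eq_true_iff_of_mem_UVAL_finalTest (h : I.IsPartial c 0 G)
    (hy : y ∈ (UVAL n (I.lift _ h.scoped_and_finalTest).encode).1) :
    y = true ↔ (fun j : Fin I.first => c j) ∈ solutions I.fn := by
  set x : Fin I.first → Bool := fun j => c j
  obtain ⟨t, z, ht, hvalid⟩ := exists_validPair_iff (I.Passes x)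
  suffices hyt : y = t by rw [hyt, ht, I.mem_solutions_iff_passes]
  refine eq_of_mem_UVAL_lift (P := fun α => α 0 = α 1 ∧
    ∀ j < I.first, 0 ≤ j → α (2 + j) = c j) (fun a => ?_) hvalid ?_ (fun v hv _ => ?_) hy
  · simp only [Expr.eval, Expr.finalTest, Bool.and_eq_true, h.eval_iff, Expr.eval_iff,
      beq_iff_eq, and_assoc]
  · obtain ⟨hb, ht', hx', -⟩ := I.glue_parts t t x z
    exact ⟨by rw [hb, ht'], fun j hj _ => by rw [← I.pad_xPart _ hj, hx', pad_of_lt _ hj]⟩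
  · exact ⟨funext fun j => hv.2 j j.2 (Nat.zero_le _), fun hvt => hv.1.trans hvt⟩

theorem mem_USAT (h : I.IsPartial c 0 G)
    (hy : y ∈ (UVAL n (I.lift _ h.scoped_and_finalTest).encode).1) : y ∈ usatAnswers I.fn := by
  intro hle
  have hsat : Sat (I.first :: I.rest) I.fn ↔ ∃ x, x ∈ solutions I.fn := Iff.rfl
  change y = true ↔ _
  rw [hsat, h.eq_true_iff_of_mem_UVAL_finalTest hy]
  refine ⟨fun hc => ⟨_, hc⟩, fun ⟨x, hx⟩ => ?_⟩
  have hcx : (fun j : Fin I.first => c j) = x := funext fun j => by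
    rw [← pad_val x j]
    exact h.agrees hle x hx j j.2 (Nat.zero_le _)
  rwa [hcx]

end IsPartial

end Instance

/-! ### Numbers in unary -/

/-- The number of letters `1` at the start of a string. -/
def ones (l : List Bool) : ℕ := (l.takeWhile id).length

/-- The string that is left after the initial letters `1` and a letter `0`. -/
def afterOnes (l : List Bool) : List Bool := (l.dropWhile id).tail

theorem ones_unary_append (i : ℕ) (l : List Bool) : ones (unary i ++ l) = i := by
  cases i <;> simp [unary, ones, List.replicate_succ]

theorem afterOnes_unary_append (i : ℕ) (l : List Bool) : afterOnes (unary i ++ l) = l := by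
  cases i <;> simp [unary, afterOnes, List.replicate_succ]

theorem ones_add_length_afterOnes_le (l : List Bool) :
    ones l + (afterOnes l).length ≤ l.length := by
  have := congrArg List.length (List.takeWhile_append_dropWhile (p := id) (l := l))
  rw [List.length_append] at this
  simp only [ones, afterOnes, List.length_tail]
  omega

/-- The first `n` numbers in unary at the start of a string, where missing numbers are read as
zero. -/
def readLengths : ℕ → List Bool → List ℕ
  | 0, _ => []
  | n + 1, l => ones l :: readLengths n (afterOnes l)

/-- The string that is left after `n` numbers in unary. -/
def dropLengths (n : ℕ) (l : List Bool) : List Bool := afterOnes^[n] l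

theorem length_readLengths (n : ℕ) (l : List Bool) : (readLengths n l).length = n := by
  induction n generalizing l with
  | zero => rfl
  | succ n ih => rw [readLengths, List.length_cons, ih]

theorem readLengths_flatMap_unary_append {n : ℕ} {ms : List ℕ} (h : ms.length = n)
    (e : List Bool) : readLengths n (ms.flatMap unary ++ e) = ms := by
  subst h
  induction ms with
  | nil => rfl
  | cons m ms ih =>
    rw [List.flatMap_cons, List.append_assoc, List.length_cons, readLengths, ones_unary_append,
      afterOnes_unary_append, ih]

theorem dropLengths_flatMap_unary_append {n : ℕ} {ms : List ℕ} (h : ms.length = n)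
    (e : List Bool) : dropLengths n (ms.flatMap unary ++ e) = e := by
  subst h
  induction ms with
  | nil => rfl
  | cons m ms ih =>
    rw [List.flatMap_cons, List.append_assoc, List.length_cons, dropLengths,
      Function.iterate_succ_apply, afterOnes_unary_append]
    exact ih

theorem sum_readLengths_add_length_dropLengths_le (n : ℕ) (l : List Bool) :
    (readLengths n l).sum + (dropLengths n l).length ≤ l.length := by
  induction n generalizing l with
  | zero => exact (Nat.zero_add _).le
  | succ n ih =>
    have h₁ := ones_add_length_afterOnes_le l
    have h₂ := ih (afterOnes l)
    rw [dropLengths] at h₂ ⊢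
    rw [readLengths, List.sum_cons, Function.iterate_succ_apply]
    omega

theorem length_flatMap_unary (ms : List ℕ) : (ms.flatMap unary).length = ms.sum + ms.length := by
  induction ms with
  | nil => rfl
  | cons m ms ih =>
    simp only [List.flatMap_cons, List.length_append, ih, List.sum_cons, List.length_cons, unary,
      List.length_replicate, List.length_nil]
    omega

/-! ### Basic programs -/

namespace Prog

variable {K : Type} [DecidableEq K] {χ : PromiseProblem} {qry : K} {S : K → List Bool}
  {R : (K → List Bool) → Prop}

theorem must_seq {p q : Prog K} {t u : ℕ}
    (h : Must χ qry p S t fun S' => Must χ qry q S' u R) : Must χ qry (seq p q) S (t + u) R :=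
  .seq h fun _ => id

theorem must_le {p : Prog K} {t u : ℕ} (h : Must χ qry p S t R) (htu : t ≤ u) :
    Must χ qry p S u R :=
  .mono h htu fun _ => id

/-- Pop a letter and branch on it. -/
def cases (k : K) (p : Option Bool → Prog K) : Prog K := loop k (fun _ => false) p

theorem must_cases {k : K} {p : Option Bool → Prog K} {t : ℕ}
    (h : Must χ qry (p (S k).head?) (Function.update S k (S k).tail) t R) :
    Must χ qry (cases k p) S (t + 1) R :=
  .loopExit rfl h

/-- Pop a letter and branch on whether it is `1`. -/
def ifOne (k : K) (p q : Prog K) : Prog K := cases k fun o => if o = some true then p else q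

theorem must_ifOne {k : K} {p q : Prog K} {t : ℕ}
    (hp : ∀ l, S k = true :: l → Must χ qry p (Function.update S k l) t R)
    (hq : ones (S k) = 0 → Must χ qry q (Function.update S k (afterOnes (S k))) t R) :
    Must χ qry (ifOne k p q) S (t + 1) R := by
  refine must_cases ?_
  rcases hS : S k with _ | ⟨_ | _, l⟩
  · rw [hS] at hq
    exact hq rfl
  · rw [hS] at hq
    exact hq rfl
  · exact hp l hS

/-- Pop all letters of a stack and run a program on each of them. -/
def forEach (k : K) (p : Bool → Prog K) : Prog K := loop k Option.isSome fun o => o.elim skip p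

theorem must_forEach_of_le {k : K} {p : Bool → Prog K} {t : ℕ}
    (Inv : List Bool → (K → List Bool) → Prop) (hk : ∀ l S, Inv l S → S k = l)
    (hp : ∀ b l S, Inv (b :: l) S → Must χ qry (p b) (Function.update S k l) t
      fun S' => ∃ l', l'.length ≤ l.length ∧ Inv l' S')
    (h : Inv (S k) S) (hR : ∀ S, Inv [] S → R S) :
    Must χ qry (forEach k p) S ((t + 1) * (S k).length + 2) R := by
  generalize hn : (S k).length = n
  induction n using Nat.strong_induction_on generalizing S with
  | _ n ih =>
    cases hl : S k with
    | nil =>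
      refine must_le (.loopExit (by simp [hl]) (t := 1) ?_) (by omega)
      rw [hl] at h ⊢
      refine .skip (hR _ ?_)
      rwa [List.tail_nil, Function.update_eq_self_iff.2 hl.symm]
    | cons b l =>
      rw [hl] at h hn
      refine must_le (.loopRepeat (by simp [hl]) (t := t) (u := (t + 1) * l.length + 2)
        (R := fun S' => ∃ l', l'.length ≤ l.length ∧ Inv l' S') ?_ ?_)
        (by rw [← hn, List.length_cons, Nat.mul_succ]; omega)
      · rw [hl]
        exact hp b l S h
      · rintro S' ⟨l', hle, hS'⟩
        obtain rfl := hk _ _ hS'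
        exact must_le (ih _ (by rw [← hn, List.length_cons]; omega) hS' rfl)
          (Nat.add_le_add_right (Nat.mul_le_mul_left _ hle) 2)

theorem must_forEach {k : K} {p : Bool → Prog K} {t : ℕ}
    (Inv : List Bool → (K → List Bool) → Prop) (hk : ∀ l S, Inv l S → S k = l)
    (hp : ∀ b l S, Inv (b :: l) S → Must χ qry (p b) (Function.update S k l) t (Inv l))
    (h : Inv (S k) S) (hR : ∀ S, Inv [] S → R S) :
    Must χ qry (forEach k p) S ((t + 1) * (S k).length + 2) R :=
  must_forEach_of_le Inv hk (fun b l S hS => .mono (hp b l S hS) le_rfl fun _ hS' =>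
    ⟨l, le_rfl, hS'⟩) h hR

/-- Put a word on top of a stack. -/
def prepend (k : K) : List Bool → Prog K
  | [] => skip
  | b :: w => seq (prepend k w) (push k b)

theorem must_prepend {k : K} {w : List Bool} (h : R (Function.update S k (w ++ S k))) :
    Must χ qry (prepend k w) S (w.length + 1) R := by
  induction w generalizing R with
  | nil => exact .skip (by simpa using h)
  | cons b w ih => exact must_seq (ih (.push (by simpa using h)))

/-- Pop everything from a stack. -/
def clear (k : K) : Prog K := forEach k fun _ => skip

theorem must_clear {k : K} (h : R (Function.update S k [])) :
    Must χ qry (clear k) S (2 * (S k).length + 2) R := by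
  refine must_forEach (fun l S' => S' = Function.update S k l) ?_ ?_
    (Function.update_eq_self k S).symm (by rintro _ rfl; exact h)
  · rintro l _ rfl
    exact Function.update_self ..
  · rintro b l _ rfl
    exact .skip (Function.update_idem ..)

/-- Move the letters of a stack one after the other to another stack. -/
def move (a b : K) : Prog K := forEach a (push b)

theorem must_move {a b : K} (hab : a ≠ b)
    (h : R (Function.update (Function.update S a []) b ((S a).reverse ++ S b))) :
    Must χ qry (move a b) S (2 * (S a).length + 2) R := by
  refine must_forEach (fun l S' => ∃ w, S a = w ++ l ∧
    S' = Function.update (Function.update S a l) b (w.reverse ++ S b)) ?_ ?_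
    ⟨[], rfl, by simp⟩ ?_
  · rintro l _ ⟨w, -, rfl⟩
    simp [hab]
  · rintro d l _ ⟨w, hw, rfl⟩
    refine .push ⟨w ++ [d], by simp [hw], ?_⟩
    rw [Function.update_comm hab, Function.update_idem]
    simp [hab.symm, Function.update_comm hab]
  · rintro _ ⟨w, hw, rfl⟩
    rw [List.append_nil] at hw
    exact hw ▸ h

/-- Move the letters of a stack one after the other to two other stacks. -/
def moveTwo (a b c : K) : Prog K := forEach a fun d => seq (push b d) (push c d)

theorem must_moveTwo {a b c : K} (hab : a ≠ b) (hac : a ≠ c) (hbc : b ≠ c)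
    (h : R (Function.update (Function.update (Function.update S a []) b ((S a).reverse ++ S b)) c
      ((S a).reverse ++ S c))) :
    Must χ qry (moveTwo a b c) S (3 * (S a).length + 2) R := by
  refine must_forEach (fun l S' => ∃ w, S a = w ++ l ∧ S' = Function.update
    (Function.update (Function.update S a l) b (w.reverse ++ S b)) c (w.reverse ++ S c)) ?_ ?_
    ⟨[], rfl, by simp⟩ ?_
  · rintro l _ ⟨w, -, rfl⟩
    simp [hab, hac]
  · rintro d l _ ⟨w, hw, rfl⟩
    refine must_seq (.push (.push ⟨w ++ [d], by simp [hw], ?_⟩))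
    funext j
    by_cases hc : j = c
    · simp [hc, hac.symm, hbc.symm]
    · by_cases hb : j = b
      · simp [hb, hbc, hab.symm]
      · by_cases ha : j = a <;> simp [ha, hb, hc, hab, hac]
  · rintro _ ⟨w, hw, rfl⟩
    rw [List.append_nil] at hw
    exact hw ▸ h

/-- Put a copy of the contents of `a` on top of `b`, using the empty stack `tmp`. -/
def copy (tmp a b : K) : Prog K := seq (move a tmp) (moveTwo tmp a b)

theorem must_copy {tmp a b : K} (hta : tmp ≠ a) (htb : tmp ≠ b) (hab : a ≠ b) (ht : S tmp = [])
    (h : R (Function.update S b (S a ++ S b))) :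
    Must χ qry (copy tmp a b) S (5 * (S a).length + 4) R := by
  refine must_le (must_seq (must_move hta.symm (must_le (must_moveTwo hta htb hab ?_)
    (u := 3 * (S a).length + 2) (by simp [ht])))) (by omega)
  convert h using 1
  funext j
  by_cases hb : j = b
  · simp [hb, ht, htb.symm, hab.symm]
  · by_cases ha : j = a
    · subst ha
      simp [hb, ht, hta.symm]
    · by_cases hj : j = tmp
      · simp [hj, ht, hta, htb]
      · simp [hj, ha, hb]

/-- The value of a sequence of words and names of stacks. -/
def itemsValue (S : K → List Bool) (l : List (List Bool ⊕ K)) : List Bool :=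
  l.flatMap (Sum.elim id S)

/-- Put a sequence of words and of copies of stacks on top of a stack. -/
def emit (tmp k : K) : List (List Bool ⊕ K) → Prog K
  | [] => skip
  | Sum.inl w :: l => seq (emit tmp k l) (prepend k w)
  | Sum.inr a :: l => seq (emit tmp k l) (copy tmp a k)

theorem must_emit {tmp k : K} {l : List (List Bool ⊕ K)} {w : List Bool} (htk : tmp ≠ k)
    (hl : ∀ a, Sum.inr a ∈ l → a ≠ k ∧ a ≠ tmp) (ht : S tmp = []) (hw : itemsValue S l = w)
    (h : R (Function.update S k (w ++ S k))) :
    Must χ qry (emit tmp k l) S (5 * w.length + 4 * l.length + 1) R := by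
  subst hw
  induction l generalizing R with
  | nil => exact .skip (by simpa [itemsValue] using h)
  | cons x l ih =>
    have hl' : ∀ a, Sum.inr a ∈ l → a ≠ k ∧ a ≠ tmp := fun a ha => hl a (by simp [ha])
    cases x with
    | inl w =>
      refine must_le (must_seq (ih hl' (must_prepend ?_))) ?_
      · simpa [itemsValue] using h
      · simp only [itemsValue, List.flatMap_cons, Sum.elim_inl, id, List.length_append,
          List.length_cons]
        omega
    | inr a =>
      obtain ⟨hak, hat⟩ := hl a (by simp)
      refine must_le (must_seq (ih hl' (must_copy hat.symm htk hak ?_ ?_))) ?_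
      · simp [htk, ht]
      · simpa [itemsValue, hak] using h
      · simp only [itemsValue, List.flatMap_cons, Sum.elim_inr, List.length_append,
          List.length_cons, Function.update_of_ne hak]
        omega

/-- The contents of the stacks after `n` letters `1` have been pushed on each stack of a list. -/
def addOnes (n : ℕ) : List K → (K → List Bool) → K → List Bool
  | [], S => S
  | a :: l, S => Function.update (addOnes n l S) a (List.replicate n true ++ addOnes n l S a)

theorem addOnes_apply (n : ℕ) (l : List K) (S : K → List Bool) (j : K) :
    addOnes n l S j = List.replicate (n * l.count j) true ++ S j := by
  induction l with
  | nil => simp [addOnes]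
  | cons a l ih =>
    by_cases hj : j = a
    · subst hj
      rw [addOnes, Function.update_self, ih, List.count_cons_self, ← List.append_assoc,
        List.replicate_append_replicate, Nat.mul_succ, Nat.add_comm]
    · rw [addOnes, Function.update_of_ne hj, ih, List.count_cons_of_ne (Ne.symm hj)]

theorem addOnes_zero (l : List K) (S : K → List Bool) : addOnes 0 l S = S := by
  funext j
  simp [addOnes_apply]

theorem addOnes_addOnes (m n : ℕ) (l : List K) (S : K → List Bool) :
    addOnes m l (addOnes n l S) = addOnes (m + n) l S := by
  funext j
  rw [addOnes_apply, addOnes_apply, addOnes_apply, ← List.append_assoc,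
    List.replicate_append_replicate, Nat.add_mul]

theorem addOnes_update {k : K} {l : List K} (hk : k ∉ l) (n : ℕ) (S : K → List Bool)
    (w : List Bool) :
    addOnes n l (Function.update S k w) = Function.update (addOnes n l S) k w := by
  funext j
  by_cases hj : j = k
  · simp [addOnes_apply, hj, List.count_eq_zero_of_not_mem hk]
  · simp [addOnes_apply, hj]

/-- Push a letter `1` on each of a list of stacks. -/
def pushOnes : List K → Prog K
  | [] => skip
  | a :: l => seq (pushOnes l) (push a true)

theorem must_pushOnes {l : List K} (h : R (addOnes 1 l S)) :
    Must χ qry (pushOnes l) S (l.length + 1) R := by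
  induction l generalizing R with
  | nil => exact .skip h
  | cons a l ih => exact must_seq (ih (.push h))

/-- Read a number in unary and push that many letters `1` on each of a list of stacks. -/
def scan (k : K) (l : List K) : Prog K :=
  loop k (· == some true) fun o => if o = some true then pushOnes l else skip

theorem must_scan {k : K} {l : List K} (hk : k ∉ l)
    (h : R (addOnes (ones (S k)) l (Function.update S k (afterOnes (S k))))) :
    Must χ qry (scan k l) S ((l.length + 2) * ones (S k) + 2) R := by
  generalize hs : S k = s at h
  induction s generalizing S with
  | nil =>
    refine must_le (.loopExit (t := 1) (by simp [hs]) ?_) (by omega)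
    rw [hs]
    exact .skip ((addOnes_zero ..).subst (motive := R) h)
  | cons b s ih =>
    cases b with
    | false =>
      refine must_le (.loopExit (t := 1) (by simp [hs]) ?_) (by omega)
      rw [hs]
      exact .skip ((addOnes_zero ..).subst (motive := R) h)
    | true =>
      refine must_le (.loopRepeat (t := l.length + 1) (by simp [hs])
        (R := fun S' => S' = addOnes 1 l (Function.update S k s)) ?_ ?_)
        (?_ : l.length + 1 + ((l.length + 2) * ones s + 2) + 1 ≤ _)
      · rw [hs]
        exact must_pushOnes rfl
      · rintro _ rfl
        refine ih (by rw [addOnes_update hk, Function.update_self]) ?_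
        rw [← addOnes_update hk, Function.update_idem, addOnes_addOnes]
        simpa [ones, afterOnes] using h
      · simp only [ones, List.takeWhile_cons, id, if_true, List.length_cons, Nat.mul_succ]
        omega

end Prog

open Prog

/-! ### The stacks -/

/-- The stacks of the programs for the two reductions. -/
inductive Stk : Type
  | inp | first | second | len | odd | even | form | zero | head | tmp | qry
  deriving DecidableEq

instance : Fintype Stk where
  elems := {.inp, .first, .second, .len, .odd, .even, .form, .zero, .head, .tmp, .qry}
  complete j := by cases j <;> decide

/-- The contents of the stacks as a record, which makes it possible to list only those that are not
empty. -/
structure Store where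
  inp : List Bool := []
  first : List Bool := []
  second : List Bool := []
  len : List Bool := []
  odd : List Bool := []
  even : List Bool := []
  form : List Bool := []
  zero : List Bool := []
  head : List Bool := []
  tmp : List Bool := []
  qry : List Bool := []

namespace Store

/-- The contents of a stack. -/
def get (s : Store) : Stk → List Bool
  | .inp => s.inp
  | .first => s.first
  | .second => s.second
  | .len => s.len
  | .odd => s.odd
  | .even => s.even
  | .form => s.form
  | .zero => s.zero
  | .head => s.head
  | .tmp => s.tmp
  | .qry => s.qry

/-- Replace the contents of a stack. -/
def set (s : Store) : Stk → List Bool → Store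
  | .inp, l => { s with inp := l }
  | .first, l => { s with first := l }
  | .second, l => { s with second := l }
  | .len, l => { s with len := l }
  | .odd, l => { s with odd := l }
  | .even, l => { s with even := l }
  | .form, l => { s with form := l }
  | .zero, l => { s with zero := l }
  | .head, l => { s with head := l }
  | .tmp, l => { s with tmp := l }
  | .qry, l => { s with qry := l }

theorem update_get (s : Store) (k : Stk) (l : List Bool) :
    Function.update s.get k l = (s.set k l).get := by
  funext j
  cases k <;> cases j <;> rfl

theorem update_nil_get (k : Stk) (l : List Bool) :
    Function.update (fun _ => []) k l = (Store.set {} k l).get := by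
  rw [← update_get]
  congr 1
  funext j
  cases j <;> rfl

end Store

/-! ### The reduction of `UVAL` to `USAT` -/

namespace Instance

variable {n : ℕ} (I : Instance n)

/-- The instance whose solutions are those with the first letter `1`. -/
def withFirst : Instance n where
  first := I.first
  rest := I.rest
  expr := .and I.expr (.var 0 0)
  first_pos := I.first_pos
  level := I.level
  expr_scoped := ⟨I.expr_scoped, I.first_pos⟩

theorem encode_withFirst : I.withFirst.encode = (I.first :: I.rest).flatMap unary ++
    [true, false] ++ I.expr.encode ++ [false, false, false, false] := by
  simp only [encode, withFirst, Expr.encode, unary, List.replicate_zero, List.cons_append,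
    List.nil_append, List.append_assoc]

theorem mem_solutions_withFirst (x : Fin I.first → Bool) :
    x ∈ solutions I.withFirst.fn ↔ x ∈ solutions I.fn ∧ x ⟨0, I.first_pos⟩ = true := by
  have hrow : assign x 0 0 = x ⟨0, I.first_pos⟩ := by
    rw [assign, Function.update_self, pad_of_lt _ I.first_pos]
  calc
    x ∈ solutions I.withFirst.fn ↔ Alt true I.rest.length 1
        (fun a => (Expr.and I.expr (.var 0 0)).eval a = true) (assign x) :=
      I.withFirst.mem_solutions_iff_alt x
    _ ↔ Alt true I.rest.length 1
        (fun a => x ⟨0, I.first_pos⟩ = true ∧ I.expr.eval a = true) (assign x) :=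
      alt_congr_of_row Nat.zero_lt_one fun a ha => by
        rw [Expr.eval, Expr.eval, Bool.and_eq_true, ha, hrow, and_comm]
    _ ↔ _ := by rw [alt_and_left, ← mem_solutions_iff_alt, and_comm]

theorem mem_uvalAnswers_of_withFirst {y : Bool} (hy : y ∈ (USAT n I.withFirst.encode).1) :
    y ∈ uvalAnswers I.first_pos I.fn := by
  rintro ⟨x, hx, huniq⟩
  have hunique : (solutions I.withFirst.fn).encard ≤ 1 := by
    rw [Set.encard_le_one_iff]
    intro a b ha hb
    rw [huniq a ((I.mem_solutions_withFirst a).1 ha).1,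
      huniq b ((I.mem_solutions_withFirst b).1 hb).1]
  have hsat : y = true ↔ ∃ z, z ∈ solutions I.withFirst.fn := by
    refine (hy I.withFirst rfl hunique).trans ?_
    rw [Sat]
    rfl
  refine ⟨x, hx, Bool.eq_iff_iff.2 (Iff.trans ?_ hsat.symm)⟩
  refine ⟨fun hfirst => ⟨x, (I.mem_solutions_withFirst x).2 ⟨hx, hfirst⟩⟩, fun ⟨z, hz⟩ => ?_⟩
  obtain ⟨hzf, hfirst⟩ := (I.mem_solutions_withFirst z).1 hz
  rwa [huniq z hzf] at hfirst

end Instance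

/-- Move `n` numbers in unary from `inp` to `tmp`. -/
def copyLengths : ℕ → Prog Stk
  | 0 => skip
  | n + 1 => seq (scan .inp [.tmp]) (seq (push .tmp false) (copyLengths n))

section Must

variable {χ : PromiseProblem} {R : (Stk → List Bool) → Prop}

theorem must_copyLengths (n : ℕ) {s : Store} {N : ℕ} (hN : s.inp.length ≤ N)
    (h : R { s with
      inp := dropLengths n s.inp
      tmp := ((readLengths n s.inp).flatMap unary).reverse ++ s.tmp }.get) :
    Must χ .qry (copyLengths n) s.get (n * (3 * N + 4) + 1) R := by
  induction n generalizing s with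
  | zero => exact must_le (.skip h) (by omega)
  | succ n ih =>
    have hle := ones_add_length_afterOnes_le s.inp
    refine must_le (must_seq (must_scan (by decide) (must_seq (.push ?_))))
      (?_ : 3 * ones s.inp + 2 + (1 + (n * (3 * N + 4) + 1)) ≤ _)
    · simp only [addOnes, Store.update_get, Store.set, Store.get]
      refine ih (by simp only; omega) ?_
      simpa [readLengths, dropLengths, unary] using h
    · rw [Nat.add_one_mul n]
      omega

/-- Call the oracle and move its answer to `inp`. -/
def answer : Prog Stk := seq call (move .qry .inp)

theorem must_answer {s : Store}
    (h : ∀ y ∈ (χ s.qry).1, R { s with inp := y :: s.inp, qry := [] }.get) :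
    Must χ .qry answer s.get 5 R := by
  refine must_seq (u := 4) (.call fun y hy => ?_)
  rw [Store.update_get]
  refine must_move (by decide) ?_
  simp only [Store.update_get, Store.set, Store.get]
  exact h y hy

/-- The program that answers a query for `UVAL` with the help of `USAT`. -/
def uvalProg (n : ℕ) : Prog Stk :=
  seq (copyLengths n) (seq (prepend .tmp [false, true]) (seq (move .inp .tmp)
    (seq (prepend .tmp [false, false, false, false]) (seq (move .tmp .qry) answer))))

theorem must_uvalProg (n : ℕ) (q : List Bool)
    (h : ∀ y ∈ (χ ((readLengths n q).flatMap unary ++ [true, false] ++ dropLengths n q ++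
      [false, false, false, false])).1, R (Store.get { inp := [y] })) :
    Must χ .qry (uvalProg n) (Store.get { inp := q })
      (n * (3 * q.length + 4) + 4 * q.length + 2 * n + 30) R := by
  have hle := sum_readLengths_add_length_dropLengths_le n q
  have htmp := length_flatMap_unary (readLengths n q)
  rw [length_readLengths] at htmp
  refine must_le (must_seq (must_copyLengths n (N := q.length) le_rfl (must_seq (must_prepend ?_))))
    (?_ : n * (3 * q.length + 4) + 1 + (3 + ((2 * (dropLengths n q).length + 2) + (5 + (2 *
      ((dropLengths n q).length + ((readLengths n q).flatMap unary).length + 6) + 2 + 5)))) ≤ _)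
  swap
  · omega
  simp only [Store.update_get, Store.set, Store.get]
  refine must_seq (must_move (by decide) ?_)
  simp only [Store.update_get, Store.set, Store.get]
  refine must_seq (must_prepend ?_)
  simp only [Store.update_get, Store.set, Store.get]
  refine must_seq (must_le (must_move (by decide) ?_) (by simp [Store.get]; omega))
  simp only [Store.update_get, Store.set, Store.get]
  refine must_answer fun y hy => h y ?_
  simpa using hy

end Must

theorem uvalProg_computes (n : ℕ) : (uvalProg n).Computes .inp .qry (UVAL n) (USAT n) := by
  refine ⟨Polynomial.C n * (3 * Polynomial.X + 4) + 4 * Polynomial.X +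
    Polynomial.C (2 * n + 30), fun q => ?_⟩
  rw [Store.update_nil_get]
  refine must_le (must_uvalProg n q fun y hy => ⟨y, ?_, (Store.update_nil_get .inp [y]).symm⟩)
    (by simp; omega)
  rintro I rfl
  refine I.mem_uvalAnswers_of_withFirst ?_
  have hlen : (I.first :: I.rest).length = n := I.level
  rw [I.encode_withFirst]
  rwa [Instance.encode, readLengths_flatMap_unary_append hlen,
    dropLengths_flatMap_unary_append hlen] at hy

theorem uval_weakClosure_subset (n : ℕ) : weakClosure (UVAL n) ⊆ UDeltaSucc n :=
  fun _ h => TuringReducible.of_computes (uvalProg_computes n) h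

/-! ### Renaming the variables of a code -/

/-- The replacement for the token that starts with the letter `a` and goes on with `l`. The tokens
of a code are the operation symbols, of two letters, and the codes of the variables. -/
def renameToken (σ : ℕ → ℕ → ℕ × ℕ) (a : Bool) : List Bool → List Bool
  | [] => [a]
  | b :: l => if a || b then [a, b] else
      (Expr.rename σ (.var (ones l) (ones (afterOnes l)))).encode

/-- The string that is left after a token. -/
def afterToken (a : Bool) : List Bool → List Bool
  | [] => []
  | b :: l => if a || b then l else afterOnes (afterOnes l)

theorem length_renameToken_add_le {σ : ℕ → ℕ → ℕ × ℕ} {m : ℕ}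
    (hσ : ∀ i j, (σ i j).1 + (σ i j).2 ≤ 2 * (i + j) + m + 2) (a : Bool) (l : List Bool) :
    (renameToken σ a l).length + (m + 8) * (afterToken a l).length ≤ (m + 8) * (l.length + 1) := by
  cases l with
  | nil => simp [renameToken, afterToken]
  | cons b l =>
    cases h : a || b with
    | true => simp [renameToken, afterToken, h]; nlinarith
    | false =>
      have hi := ones_add_length_afterOnes_le l
      have hj := ones_add_length_afterOnes_le (afterOnes l)
      have hvar := hσ (ones l) (ones (afterOnes l))
      have hlen : (m + 8) * (ones l + ones (afterOnes l) + (afterOnes (afterOnes l)).length) ≤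
          (m + 8) * l.length := Nat.mul_le_mul_left _ (by omega)
      simp only [renameToken, afterToken, h, Bool.false_eq_true, if_false, Expr.rename, Expr.encode,
        unary, List.length_cons, List.length_append, List.length_replicate, List.length_nil]
      nlinarith

theorem length_afterToken_le (a : Bool) (l : List Bool) : (afterToken a l).length ≤ l.length := by
  cases l with
  | nil => rfl
  | cons b l =>
    have hi := ones_add_length_afterOnes_le l
    have hj := ones_add_length_afterOnes_le (afterOnes l)
    rw [afterToken, List.length_cons]
    split_ifs <;> omega

/-- Rename the variables in a code. The definition makes sense for all strings, since the reduction
runs on them, too. -/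
def renameCode (σ : ℕ → ℕ → ℕ × ℕ) : List Bool → List Bool
  | [] => []
  | a :: l => renameToken σ a l ++ renameCode σ (afterToken a l)
  termination_by l => l.length
  decreasing_by exact Nat.lt_succ_of_le (length_afterToken_le a l)

theorem renameCode_encode_append (σ : ℕ → ℕ → ℕ × ℕ) (e : Expr) (l : List Bool) :
    renameCode σ (e.encode ++ l) = (e.rename σ).encode ++ renameCode σ l := by
  induction e generalizing l with
  | var i j =>
    simp [Expr.encode, renameCode, renameToken, afterToken, ones_unary_append,
      afterOnes_unary_append]
  | not e ih => simp [Expr.encode, Expr.rename, renameCode, renameToken, afterToken, ih]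
  | and e f ihe ihf =>
    simp [Expr.encode, Expr.rename, renameCode, renameToken, afterToken, ihe, ihf]
  | or e f ihe ihf =>
    simp [Expr.encode, Expr.rename, renameCode, renameToken, afterToken, ihe, ihf]

theorem renameCode_encode (σ : ℕ → ℕ → ℕ × ℕ) (e : Expr) :
    renameCode σ e.encode = (e.rename σ).encode := by
  simpa [renameCode] using renameCode_encode_append σ e []

theorem length_renameCode_le {σ : ℕ → ℕ → ℕ × ℕ} {m : ℕ}
    (hσ : ∀ i j, (σ i j).1 + (σ i j).2 ≤ 2 * (i + j) + m + 2) (l : List Bool) :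
    (renameCode σ l).length ≤ (m + 8) * l.length := by
  induction l using renameCode.induct with
  | case1 => simp [renameCode]
  | case2 a l ih =>
    have := length_renameToken_add_le hσ a l
    rw [renameCode, List.length_append, List.length_cons]
    omega

theorem evenRenaming_le (i j : ℕ) :
    (evenRenaming i j).1 + (evenRenaming i j).2 ≤ 2 * (i + j) + 0 + 2 := by
  cases i <;> simp only [evenRenaming] <;> omega

theorem oddRenaming_le (m i j : ℕ) :
    (oddRenaming m i j).1 + (oddRenaming m i j).2 ≤ 2 * (i + j) + m + 2 := by
  match i with
  | 0 | 1 | i + 2 => simp only [oddRenaming]; omega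

/-- Push a letter on both outputs of the renaming program. -/
def pushBoth (b : Bool) : Prog Stk := seq (push .odd b) (push .even b)

/-- Read the rest of a variable of the first argument. -/
def readFirst : Prog Stk :=
  seq (prepend .odd [true, true, false]) (seq (prepend .even [true, true, false])
    (seq (scan .inp [.odd, .even]) (pushBoth false)))

/-- Read the rest of a variable of the second argument. -/
def readSecond : Prog Stk :=
  seq (prepend .odd [true, true, false]) (seq (copy .tmp .first .odd)
    (seq (prepend .even [false, true]) (seq (scan .inp [.odd, .even, .even]) (pushBoth false))))

/-- Read the rest of a variable of one of the later arguments. -/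
def readLater : Prog Stk :=
  seq (prepend .odd [true]) (seq (prepend .even [true, true])
    (seq (scan .inp [.odd, .even]) (seq (pushBoth false) (seq (push .odd true)
      (seq (scan .inp [.odd, .odd, .even, .even]) (pushBoth false))))))

/-- Read the rest of a variable. -/
def readVar : Prog Stk :=
  seq (pushBoth false) (seq (pushBoth false) (ifOne .inp (ifOne .inp readLater readSecond)
    readFirst))

/-- Rename the variables in the token that starts with the letter `a`. -/
def renameStep (a : Bool) : Prog Stk :=
  cases .inp fun o => o.elim (pushBoth a) fun b =>
    if a || b then seq (pushBoth a) (pushBoth b) else readVar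

/-- Rename the variables in the code on `inp`, and put the reversed results for the two renamings
on `odd` and `even`. -/
def renameProg : Prog Stk := forEach .inp renameStep

theorem reverse_unary_append (i : ℕ) (l : List Bool) :
    (unary i).reverse ++ l = false :: (List.replicate i true ++ l) := by
  simp [unary]

theorem replicate_add_append {α : Type*} (i j : ℕ) (a : α) (l : List α) :
    List.replicate (i + j) a ++ l = List.replicate j a ++ (List.replicate i a ++ l) := by
  rw [Nat.add_comm, List.replicate_add, List.append_assoc]

theorem ones_true_cons (l : List Bool) : ones (true :: l) = ones l + 1 := rfl

theorem afterOnes_true_cons (l : List Bool) : afterOnes (true :: l) = afterOnes l := rfl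

section Must

variable {χ : PromiseProblem} {R : (Stk → List Bool) → Prop} {s : Store} {m : ℕ}

theorem must_pushBoth {b : Bool} (h : R { s with odd := b :: s.odd, even := b :: s.even }.get) :
    Must χ .qry (pushBoth b) s.get 2 R := by
  refine must_seq (.push (.push ?_))
  simpa only [Store.update_get, Store.set, Store.get] using h

theorem must_readFirst (h : R { s with
      inp := afterOnes s.inp
      odd := (unary 0 ++ unary (2 + ones s.inp)).reverse ++ s.odd
      even := (unary 0 ++ unary (2 + ones s.inp)).reverse ++ s.even }.get) :
    Must χ .qry readFirst s.get (4 * ones s.inp + 12) R := by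
  refine must_le (must_seq (must_prepend ?_)) (?_ : 4 + (4 + (4 * ones s.inp + 2 + 2)) ≤ _)
  · simp only [Store.update_get, Store.set, Store.get]
    refine must_seq (must_prepend ?_)
    simp only [Store.update_get, Store.set, Store.get]
    refine must_seq (must_scan (by decide) ?_)
    simp only [addOnes, Store.update_get, Store.set, Store.get]
    refine must_pushBoth ?_
    simp only [List.reverse_append, List.append_assoc, List.cons_append, reverse_unary_append,
      replicate_add_append] at h
    exact h
  · omega

theorem must_readSecond (hfirst : s.first = List.replicate m true) (htmp : s.tmp = [])
    (h : R { s with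
      inp := afterOnes s.inp
      odd := (unary 0 ++ unary (2 + m + ones s.inp)).reverse ++ s.odd
      even := (unary 1 ++ unary (2 * ones s.inp)).reverse ++ s.even }.get) :
    Must χ .qry readSecond s.get (5 * ones s.inp + 5 * m + 15) R := by
  refine must_le (must_seq (must_prepend ?_))
    (?_ : 4 + (5 * m + 4 + (3 + (5 * ones s.inp + 2 + 2))) ≤ _)
  · simp only [Store.update_get, Store.set, Store.get]
    refine must_seq (must_le (must_copy (by decide) (by decide) (by decide) htmp ?_)
      (by simp [Store.get, hfirst]))
    simp only [Store.update_get, Store.set, Store.get]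
    refine must_seq (must_prepend ?_)
    simp only [Store.update_get, Store.set, Store.get]
    refine must_seq (must_scan (by decide) ?_)
    simp only [addOnes, Store.update_get, Store.set, Store.get]
    refine must_pushBoth ?_
    simp only [List.reverse_append, List.append_assoc, List.cons_append, reverse_unary_append,
      two_mul, replicate_add_append, ← hfirst] at h
    exact h
  · omega

theorem must_readLater (h : R { s with
      inp := afterOnes (afterOnes s.inp)
      odd := (unary (1 + ones s.inp) ++ unary (1 + 2 * ones (afterOnes s.inp))).reverse ++ s.odd
      even := (unary (2 + ones s.inp) ++ unary (2 * ones (afterOnes s.inp))).reverse ++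
        s.even }.get) :
    Must χ .qry readLater s.get (6 * s.inp.length + 16) R := by
  have hi := ones_add_length_afterOnes_le s.inp
  have hj := ones_add_length_afterOnes_le (afterOnes s.inp)
  refine must_le (must_seq (must_prepend ?_)) (?_ : 2 + (3 + (4 * ones s.inp + 2 +
    (2 + (1 + (6 * ones (afterOnes s.inp) + 2 + 2))))) ≤ _)
  · simp only [Store.update_get, Store.set, Store.get]
    refine must_seq (must_prepend ?_)
    simp only [Store.update_get, Store.set, Store.get]
    refine must_seq (must_scan (by decide) ?_)
    simp only [addOnes, Store.update_get, Store.set, Store.get]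
    refine must_seq (must_pushBoth (must_seq (.push ?_)))
    simp only [Store.update_get, Store.set, Store.get]
    refine must_seq (must_scan (by decide) ?_)
    simp only [addOnes, Store.update_get, Store.set, Store.get]
    refine must_pushBoth ?_
    simp only [List.reverse_append, List.append_assoc, List.cons_append, reverse_unary_append,
      two_mul, replicate_add_append] at h
    exact h
  · omega

theorem must_readVar (hfirst : s.first = List.replicate m true) (htmp : s.tmp = [])
    (h : R { s with
      inp := afterOnes (afterOnes s.inp)
      odd := (Expr.rename (oddRenaming m)
        (.var (ones s.inp) (ones (afterOnes s.inp)))).encode.reverse ++ s.odd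
      even := (Expr.rename evenRenaming
        (.var (ones s.inp) (ones (afterOnes s.inp)))).encode.reverse ++ s.even }.get) :
    Must χ .qry readVar s.get (6 * s.inp.length + 5 * m + 22) R := by
  have hi := ones_add_length_afterOnes_le s.inp
  refine must_le (must_seq (must_pushBoth (must_seq (must_pushBoth (must_ifOne
    (t := 6 * s.inp.length + 5 * m + 17) (fun l (hl : s.inp = true :: l) => ?_) fun h₀ => ?_)))))
    (by omega)
  · rw [hl, ones_true_cons, afterOnes_true_cons] at h
    rw [hl, List.length_cons]
    refine must_le (must_ifOne (t := 6 * l.length + 5 * m + 15) (fun l' hl' => ?_) fun h₀ => ?_)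
      (by omega)
    · obtain rfl : l = true :: l' := by simpa [Store.update_get, Store.set] using hl'
      rw [ones_true_cons, afterOnes_true_cons] at h
      simp only [Store.update_get, Store.set]
      refine must_le (must_readLater ?_) (by simp; omega)
      simpa [Expr.rename, Expr.encode, evenRenaming, oddRenaming, Nat.add_comm 1,
        Nat.add_comm 2] using h
    · simp only [Store.update_get, Store.set, Store.get] at h₀ ⊢
      refine must_le (must_readSecond hfirst htmp ?_) ?_
      · simpa [Expr.rename, Expr.encode, evenRenaming, oddRenaming, h₀] using h
      · rw [hl, ones_true_cons, afterOnes_true_cons, List.length_cons] at hi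
        have := ones_add_length_afterOnes_le (afterOnes l)
        simp only
        omega
  · simp only [Store.update_get, Store.set, Store.get] at h₀ ⊢
    refine must_le (must_readFirst ?_) ?_
    · simpa [Expr.rename, Expr.encode, evenRenaming, oddRenaming, h₀] using h
    · have := ones_add_length_afterOnes_le (afterOnes s.inp)
      simp only
      omega

theorem must_renameStep {a : Bool} (hfirst : s.first = List.replicate m true) (htmp : s.tmp = [])
    (h : R { s with
      inp := afterToken a s.inp
      odd := (renameToken (oddRenaming m) a s.inp).reverse ++ s.odd
      even := (renameToken evenRenaming a s.inp).reverse ++ s.even }.get) :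
    Must χ .qry (renameStep a) s.get (6 * s.inp.length + 5 * m + 23) R := by
  refine must_cases (t := 6 * s.inp.length + 5 * m + 22) ?_
  simp only [Store.update_get, Store.set, Store.get]
  rcases hinp : s.inp with _ | ⟨b, l⟩
  · rw [hinp] at h
    exact must_le (must_pushBoth h) (by omega)
  · rw [hinp, afterToken, renameToken, renameToken] at h
    rw [List.head?_cons, Option.elim_some, List.tail_cons, List.length_cons]
    split_ifs at h ⊢ with hab
    · refine must_le (must_seq (must_pushBoth (must_pushBoth ?_))) (by omega)
      simpa using h
    · exact must_le (must_readVar hfirst htmp h) (by simp only; omega)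

theorem must_renameProg (hfirst : s.first = List.replicate m true) (htmp : s.tmp = [])
    (h : R { s with
      inp := []
      odd := (renameCode (oddRenaming m) s.inp).reverse ++ s.odd
      even := (renameCode evenRenaming s.inp).reverse ++ s.even }.get) :
    Must χ .qry renameProg s.get ((6 * s.inp.length + 5 * m + 24) * s.inp.length + 2) R := by
  refine must_forEach_of_le (t := 6 * s.inp.length + 5 * m + 23) (fun l S =>
    l.length ≤ s.inp.length ∧ ∃ o e, S = { s with inp := l, odd := o, even := e }.get ∧
      (renameCode (oddRenaming m) l).reverse ++ o =
        (renameCode (oddRenaming m) s.inp).reverse ++ s.odd ∧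
      (renameCode evenRenaming l).reverse ++ e =
        (renameCode evenRenaming s.inp).reverse ++ s.even)
    ?_ ?_ ⟨le_rfl, s.odd, s.even, rfl, rfl, rfl⟩ ?_
  · rintro l _ ⟨-, o, e, rfl, -⟩
    rfl
  · rintro a l _ ⟨hl, o, e, rfl, ho, he⟩
    have hle := length_afterToken_le a l
    rw [List.length_cons] at hl
    rw [renameCode, List.reverse_append, List.append_assoc] at ho he
    simp only [Store.update_get, Store.set]
    refine must_le (.mono (must_renameStep hfirst htmp rfl) le_rfl ?_) ?_
    · rintro _ rfl
      exact ⟨afterToken a l, hle, by omega, _, _, rfl, ho, he⟩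
    · simp only
      omega
  · rintro _ ⟨-, o, e, rfl, ho, he⟩
    rw [renameCode, List.reverse_nil, List.nil_append] at ho he
    exact ho ▸ he ▸ h

end Must

/-! ### The codes of the lengths and of the core formula -/

/-- The items whose value is `c` plus the sum of the lengths of the stacks `l`, in unary, if these
stacks have only letters `1`. -/
def unaryItems (c : ℕ) (l : List Stk) : List (List Bool ⊕ Stk) :=
  .inl (List.replicate c true) :: l.map .inr ++ [.inl [false]]

theorem itemsValue_unaryItems {S : Stk → List Bool} {c : ℕ} {l : List Stk}
    (hl : ∀ a ∈ l, ∀ b ∈ S a, b = true) :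
    itemsValue S (unaryItems c l) = unary (c + (l.map fun a => (S a).length).sum) := by
  have hflat : l.flatMap S = List.replicate (l.map fun a => (S a).length).sum true :=
    List.eq_replicate_iff.2 ⟨List.length_flatMap, fun b hb => by
      obtain ⟨a, ha, hba⟩ := List.mem_flatMap.1 hb
      exact hl a ha b hba⟩
  rw [unary, List.replicate_add, ← hflat]
  simp [itemsValue, unaryItems, List.flatMap_map]

/-- The items whose value is the code of the variable `i`, `j`, where `j` is `c` plus the sum of the
lengths of the stacks `l`. -/
def varItems (i c : ℕ) (l : List Stk) : List (List Bool ⊕ Stk) :=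
  .inl ([false, false] ++ unary i) :: unaryItems c l

theorem itemsValue_varItems {S : Stk → List Bool} {i c : ℕ} {l : List Stk}
    (hl : ∀ a ∈ l, ∀ b ∈ S a, b = true) : itemsValue S (varItems i c l) =
      (Expr.var i (c + (l.map fun a => (S a).length).sum)).encode := by
  rw [Expr.encode, ← itemsValue_unaryItems hl]
  rfl

theorem itemsValue_append (S : Stk → List Bool) (l l' : List (List Bool ⊕ Stk)) :
    itemsValue S (l ++ l') = itemsValue S l ++ itemsValue S l' := List.flatMap_append

theorem itemsValue_inl_cons (S : Stk → List Bool) (w : List Bool) (l : List (List Bool ⊕ Stk)) :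
    itemsValue S (.inl w :: l) = w ++ itemsValue S l := rfl

/-- The code of the part of `Expr.geIter` for the letter `j`. -/
def geStep (m₁ j : ℕ) : List Bool :=
  [true, true, true, false] ++ (Expr.var 1 (2 * j)).encode ++
    (Expr.not (.var 0 (2 + m₁ + j))).encode ++ [true, false, true, true] ++
    (Expr.var 1 (2 * j)).encode ++ (Expr.not (.var 0 (2 + m₁ + j))).encode

/-- The code of the part of `Expr.zeroIter` for the letter `j`. -/
def zeroStep (m₁ j : ℕ) : List Bool :=
  [true, false, true, true] ++ (Expr.not (.var 0 1)).encode ++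
    (Expr.not (.var 0 (2 + m₁ + j))).encode

theorem encode_geIter (m₁ m : ℕ) (e : Expr) :
    (e.geIter m₁ m).encode = (List.range m).flatMap (geStep m₁) ++ e.encode := by
  induction m generalizing e with
  | zero => rfl
  | succ m ih => simp [Expr.geIter, ih, geStep, Expr.encode, List.range_succ]

theorem encode_zeroIter (m₁ m : ℕ) (e : Expr) :
    (e.zeroIter m₁ m).encode = (List.range m).flatMap (zeroStep m₁) ++ e.encode := by
  induction m generalizing e with
  | zero => rfl
  | succ m ih => simp [Expr.zeroIter, ih, zeroStep, Expr.encode, List.range_succ]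

theorem length_encode_var (i j : ℕ) : (Expr.var i j).encode.length = i + j + 4 := by
  simp only [Expr.encode, unary, List.length_cons, List.length_append, List.length_replicate,
    List.length_nil]
  omega

theorem length_encode_not (e : Expr) : (Expr.not e).encode.length = e.encode.length + 2 := by
  simp [Expr.encode]

theorem length_geStep (m₁ j : ℕ) : (geStep m₁ j).length = 2 * m₁ + 6 * j + 34 := by
  simp only [geStep, List.length_append, List.length_cons, List.length_nil, length_encode_var,
    length_encode_not]
  omega

theorem length_zeroStep (m₁ j : ℕ) : (zeroStep m₁ j).length = m₁ + j + 19 := by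
  simp only [zeroStep, List.length_append, List.length_cons, List.length_nil, length_encode_var,
    length_encode_not]
  omega

/-- The code of the formula `Expr.core`, given the code of `f`. -/
def coreCode (m₁ m₂ : ℕ) (f : List Bool) : List Bool :=
  (List.range m₂).flatMap (zeroStep m₁) ++ ([true, false, true, true, true, false] ++
    (Expr.not (.var 0 1)).encode ++ ((List.range m₂).flatMap (geStep m₁) ++
    ((Expr.not (.var 0 1)).encode ++ (renameCode evenRenaming f ++
    ([true, true] ++ (Expr.var 0 1).encode ++ [false, true] ++
    renameCode (oddRenaming m₁) f)))))

theorem coreCode_encode (m₁ m₂ : ℕ) (f : Expr) :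
    coreCode m₁ m₂ f.encode = (f.core m₁ m₂).encode := by
  simp only [coreCode, Expr.core, encode_zeroIter, Expr.encode, encode_geIter, renameCode_encode,
    List.append_assoc, List.cons_append, List.nil_append]

theorem length_flatMap_range_le {f : ℕ → List Bool} {m b : ℕ} (h : ∀ j < m, (f j).length ≤ b) :
    ((List.range m).flatMap f).length ≤ m * b := by
  rw [List.length_flatMap]
  refine (List.sum_le_card_nsmul _ b ?_).trans_eq ?_
  · simpa using h
  · simp

theorem length_flatMap_zeroStep_le {m₁ m₂ N : ℕ} (h : m₁ + m₂ ≤ N) :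
    ((List.range m₂).flatMap (zeroStep m₁)).length ≤ N * (2 * N + 19) :=
  (length_flatMap_range_le fun j hj => by rw [length_zeroStep]; omega).trans
    (Nat.mul_le_mul_right (2 * N + 19) (by omega))

theorem length_flatMap_geStep_le {m₁ m₂ N : ℕ} (h : m₁ + m₂ ≤ N) :
    ((List.range m₂).flatMap (geStep m₁)).length ≤ N * (8 * N + 34) :=
  (length_flatMap_range_le fun j hj => by rw [length_geStep]; omega).trans
    (Nat.mul_le_mul_right (8 * N + 34) (by omega))

theorem length_renameCode_add_le {m N : ℕ} {f : List Bool} (h : m + f.length ≤ N) :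
    (renameCode (oddRenaming m) f).length + (renameCode evenRenaming f).length ≤ (N + 16) * N := by
  calc
    _ ≤ (m + 8) * f.length + (0 + 8) * f.length :=
      Nat.add_le_add (length_renameCode_le (oddRenaming_le m) f)
        (length_renameCode_le evenRenaming_le f)
    _ = (m + 16) * f.length := by ring
    _ ≤ (N + 16) * N := Nat.mul_le_mul (by omega) (by omega)

theorem length_coreCode_le {m₁ m₂ N : ℕ} {f : List Bool} (h : m₁ + m₂ + f.length ≤ N) :
    (coreCode m₁ m₂ f).length ≤ 12 * N ^ 2 + 69 * N + 29 := by
  have hzero := length_flatMap_zeroStep_le (m₁ := m₁) (m₂ := m₂) (N := N) (by omega)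
  have hge := length_flatMap_geStep_le (m₁ := m₁) (m₂ := m₂) (N := N) (by omega)
  have hren := length_renameCode_add_le (m := m₁) (f := f) (N := N) (by omega)
  simp only [coreCode, List.length_append, List.length_cons, List.length_nil, length_encode_var,
    length_encode_not]
  nlinarith

theorem headD_le_sum (ms : List ℕ) : ms.headD 0 ≤ ms.sum := by
  cases ms <;> simp

theorem length_flatMap_liftLengths_le {m₁ N : ℕ} {ms : List ℕ} (h : m₁ + ms.sum ≤ N) :
    ((liftLengths m₁ ms).flatMap unary).length ≤ ms.length * (2 * N + 1) + N + 3 := by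
  have hhead := headD_le_sum ms
  have := Nat.mul_le_mul_left ms.length (show 2 * ms.sum + 1 ≤ 2 * N + 1 by omega)
  rw [length_flatMap_unary]
  simp only [liftLengths, List.sum_cons, List.sum_replicate, List.length_cons,
    List.length_replicate, smul_eq_mul]
  rw [Nat.mul_succ] at this
  omega

/-! ### Setting up the search -/

/-- Read `k` numbers and add twice their sum to `len`. -/
def skipLengths : ℕ → Prog Stk
  | 0 => skip
  | k + 1 => seq (scan .inp [.len, .len]) (skipLengths k)

/-- Read `k` numbers, put the first on `second` and twice their sum on `len`. -/
def scanRest : ℕ → Prog Stk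
  | 0 => skip
  | k + 1 => seq (scan .inp [.second, .len, .len]) (skipLengths k)

/-- The items for the codes of the lengths of the new formula, which has `k` later arguments. -/
def headItems (k : ℕ) : List (List Bool ⊕ Stk) :=
  unaryItems 2 [.first, .second] ++ (List.replicate k [.len]).flatMap (unaryItems 0)

theorem length_headItems (k : ℕ) : (headItems k).length = 3 * k + 4 := by
  simp only [headItems, unaryItems, List.length_append, List.length_map, List.length_cons,
    List.length_nil, List.length_flatMap, List.map_replicate, List.sum_replicate, smul_eq_mul]
  omega

/-- The items for `geStep`. -/
def geItems : List (List Bool ⊕ Stk) :=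
  .inl [true, true, true, false] :: varItems 1 0 [.second, .second] ++
    (.inl [false, true] :: varItems 0 2 [.first, .second]) ++
    (.inl [true, false, true, true] :: varItems 1 0 [.second, .second]) ++
    (.inl [false, true] :: varItems 0 2 [.first, .second])

/-- The items for `zeroStep`. -/
def zeroItems : List (List Bool ⊕ Stk) :=
  .inl ([true, false, true, true] ++ (Expr.not (.var 0 1)).encode ++ [false, true]) ::
    varItems 0 2 [.first, .second]

/-- Put the codes for one letter of the second argument on `form` and `zero`. -/
def letterProg : Prog Stk := seq (emit .tmp .form geItems) (emit .tmp .zero zeroItems)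

/-- Put the codes for all letters of the second argument on `form` and `zero`. -/
def stepsProg : Prog Stk := forEach .second fun _ => letterProg

/-- Put together the code of the core formula. -/
def formProg : Prog Stk :=
  seq (move .odd .form) (seq
    (prepend .form ([true, true] ++ (Expr.var 0 1).encode ++ [false, true])) (seq
    (move .even .form) (seq
    (prepend .form (Expr.not (.var 0 1)).encode) (seq
    stepsProg (seq
    (prepend .form ([true, false, true, true, true, false] ++ (Expr.not (.var 0 1)).encode)) (seq
    (copy .tmp .zero .form)
    (clear .zero)))))))

/-- Compute the core formula and the lengths of the arguments of the new formulas. -/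
def setupProg (k : ℕ) : Prog Stk :=
  seq (scan .inp [.first]) (seq (scanRest k) (seq (emit .tmp .head (headItems k))
    (seq renameProg formProg)))

section Must

variable {χ : PromiseProblem} {R : (Stk → List Bool) → Prop} {s : Store} {k m₁ m₂ N : ℕ}

theorem must_skipLengths (hN : s.inp.length ≤ N)
    (h : R { s with
      inp := dropLengths k s.inp
      len := List.replicate (2 * (readLengths k s.inp).sum) true ++ s.len }.get) :
    Must χ .qry (skipLengths k) s.get (k * (5 * N + 4) + 1) R := by
  induction k generalizing s with
  | zero => exact must_le (.skip (by simpa [dropLengths, readLengths] using h)) (by omega)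
  | succ k ih =>
    have hle := ones_add_length_afterOnes_le s.inp
    refine must_le (must_seq (must_scan (by decide) ?_))
      (?_ : 4 * ones s.inp + 2 + (k * (5 * N + 4) + 1) ≤ _)
    · simp only [addOnes, Store.update_get, Store.set, Store.get]
      refine ih (by simp only; omega) ?_
      simpa only [readLengths, dropLengths, List.sum_cons, Nat.mul_add, two_mul (ones s.inp),
        replicate_add_append, Function.iterate_succ_apply] using h
    · rw [Nat.add_one_mul k]
      omega

theorem must_scanRest (hN : s.inp.length ≤ N)
    (h : R { s with
      inp := dropLengths k s.inp
      second := List.replicate ((readLengths k s.inp).headD 0) true ++ s.second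
      len := List.replicate (2 * (readLengths k s.inp).sum) true ++ s.len }.get) :
    Must χ .qry (scanRest k) s.get (k * (5 * N + 4) + 1) R := by
  cases k with
  | zero => exact must_le (.skip (by simpa [dropLengths, readLengths] using h)) (by omega)
  | succ k =>
    have hle := ones_add_length_afterOnes_le s.inp
    refine must_le (must_seq (must_scan (by decide) ?_))
      (?_ : 5 * ones s.inp + 2 + (k * (5 * N + 4) + 1) ≤ _)
    · simp only [addOnes, Store.update_get, Store.set, Store.get]
      refine must_skipLengths (by simp only; omega) ?_
      simpa only [readLengths, dropLengths, List.sum_cons, List.headD_cons, Nat.mul_add,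
        two_mul (ones s.inp), replicate_add_append, Function.iterate_succ_apply] using h
    · rw [Nat.add_one_mul k]
      omega

theorem itemsValue_headItems {ms : List ℕ} (hms : ms.length = k)
    (hfirst : s.first = List.replicate m₁ true)
    (hsecond : s.second = List.replicate (ms.headD 0) true)
    (hlen : s.len = List.replicate (2 * ms.sum) true) :
    itemsValue s.get (headItems k) = (liftLengths m₁ ms).flatMap unary := by
  subst hms
  rw [headItems, itemsValue_append, itemsValue_unaryItems (by simp [Store.get, hfirst, hsecond])]
  have hrest : itemsValue s.get (unaryItems 0 [.len]) = unary (2 * ms.sum) := by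
    rw [itemsValue_unaryItems (by simp [Store.get, hlen])]
    simp [Store.get, hlen]
  rw [itemsValue] at hrest ⊢
  rw [List.flatMap_assoc, List.flatMap_replicate, hrest]
  simp [Store.get, hfirst, hsecond, liftLengths, List.flatMap_replicate, Nat.add_assoc]

theorem itemsValue_geItems (hfirst : s.first = List.replicate m₁ true)
    (hsecond : s.second = List.replicate m₂ true) : itemsValue s.get geItems = geStep m₁ m₂ := by
  have hvar₀ := itemsValue_varItems (S := s.get) (i := 0) (c := 2) (l := [.first, .second])
    (by simp [Store.get, hfirst, hsecond])
  have hvar₁ := itemsValue_varItems (S := s.get) (i := 1) (c := 0) (l := [.second, .second])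
    (by simp [Store.get, hsecond])
  simp [geItems, itemsValue_append, itemsValue_inl_cons, hvar₀, hvar₁, Store.get, hfirst, hsecond,
    geStep, Expr.encode, two_mul, Nat.add_assoc]

theorem itemsValue_zeroItems (hfirst : s.first = List.replicate m₁ true)
    (hsecond : s.second = List.replicate m₂ true) :
    itemsValue s.get zeroItems = zeroStep m₁ m₂ := by
  rw [zeroItems, itemsValue_inl_cons,
    itemsValue_varItems (by simp [Store.get, hfirst, hsecond])]
  simp [Store.get, hfirst, hsecond, zeroStep, Expr.encode, Nat.add_assoc]

theorem must_letterProg (hfirst : s.first = List.replicate m₁ true)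
    (hsecond : s.second = List.replicate m₂ true) (htmp : s.tmp = [])
    (h : R { s with form := geStep m₁ m₂ ++ s.form, zero := zeroStep m₁ m₂ ++ s.zero }.get) :
    Must χ .qry letterProg s.get (15 * m₁ + 35 * m₂ + 387) R := by
  refine must_le (must_seq (must_emit (by decide) (by simp [geItems, varItems, unaryItems]) htmp
    (itemsValue_geItems hfirst hsecond) ?_)) (?_ : 5 * (geStep m₁ m₂).length + 4 * 24 + 1 +
      (5 * (zeroStep m₁ m₂).length + 4 * 6 + 1) ≤ _)
  · rw [Store.update_get]
    refine must_emit (by decide) (by simp [zeroItems, varItems, unaryItems]) htmp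
      (itemsValue_zeroItems hfirst hsecond) ?_
    rw [Store.update_get]
    exact h
  · rw [length_geStep, length_zeroStep]
    omega

theorem must_stepsProg (hfirst : s.first = List.replicate m₁ true)
    (hsecond : s.second = List.replicate m₂ true) (htmp : s.tmp = [])
    (h : R { s with
      second := []
      form := (List.range m₂).flatMap (geStep m₁) ++ s.form
      zero := (List.range m₂).flatMap (zeroStep m₁) ++ s.zero }.get) :
    Must χ .qry stepsProg s.get ((15 * m₁ + 35 * m₂ + 390) * m₂ + 2) R := by
  refine must_le (must_forEach (t := 15 * m₁ + 35 * m₂ + 389) (fun l S =>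
    ∃ j ≤ m₂, l = List.replicate j true ∧ ∃ f z,
      S = { s with second := l, form := f, zero := z }.get ∧
      (List.range j).flatMap (geStep m₁) ++ f = (List.range m₂).flatMap (geStep m₁) ++ s.form ∧
      (List.range j).flatMap (zeroStep m₁) ++ z =
        (List.range m₂).flatMap (zeroStep m₁) ++ s.zero)
    ?_ ?_ ⟨m₂, le_rfl, hsecond, s.form, s.zero, rfl, rfl, rfl⟩ ?_) (by simp [Store.get, hsecond])
  · rintro l _ ⟨j, -, -, f, z, rfl, -⟩
    rfl
  · rintro b l _ ⟨_ | j, hj, hl, f, z, rfl, hf, hz⟩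
    · cases hl
    obtain ⟨rfl, rfl⟩ := List.cons.inj hl
    rw [List.range_succ, List.flatMap_append, List.flatMap_singleton, List.append_assoc] at hf hz
    simp only [Store.update_get, Store.set]
    refine must_le (must_letterProg hfirst rfl htmp ?_) (by omega)
    exact ⟨j, by omega, rfl, _, _, rfl, hf, hz⟩
  · rintro _ ⟨j, -, hj, f, z, rfl, hf, hz⟩
    obtain rfl := (List.replicate_eq_nil_iff true).1 hj.symm
    rw [List.range_zero, List.flatMap_nil, List.nil_append] at hf hz
    exact hf ▸ hz ▸ h

theorem must_formProg {f : List Bool} (hN : m₁ + m₂ + f.length ≤ N)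
    (hfirst : s.first = List.replicate m₁ true) (hsecond : s.second = List.replicate m₂ true)
    (hodd : s.odd = (renameCode (oddRenaming m₁) f).reverse)
    (heven : s.even = (renameCode evenRenaming f).reverse)
    (hform : s.form = []) (hzero : s.zero = []) (htmp : s.tmp = [])
    (h : R { s with second := [], odd := [], even := [], form := coreCode m₁ m₂ f }.get) :
    Must χ .qry formProg s.get (66 * N ^ 2 + 555 * N + 46) R := by
  refine must_le (must_seq (must_move (by decide) (must_seq (must_prepend ?_))))
    (?_ : 2 * s.odd.length + 2 + (10 + (2 * s.even.length + 2 + (8 +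
      ((15 * m₁ + 35 * m₂ + 390) * m₂ + 2 + (14 +
        (5 * ((List.range m₂).flatMap (zeroStep m₁)).length + 4 +
        (2 * ((List.range m₂).flatMap (zeroStep m₁)).length + 2))))))) ≤ _)
  · simp only [Store.update_get, Store.set, Store.get]
    refine must_seq (must_move (by decide) ?_)
    simp only [Store.update_get, Store.set, Store.get]
    refine must_seq (must_prepend ?_)
    simp only [Store.update_get, Store.set, Store.get]
    refine must_seq (must_stepsProg hfirst hsecond htmp (must_seq (must_prepend ?_)))
    simp only [Store.update_get, Store.set, Store.get, hzero, List.append_nil]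
    refine must_seq (must_copy (by decide) (by decide) (by decide) htmp (must_clear ?_))
    simp only [Store.update_get, Store.set, Store.get]
    simpa only [hodd, heven, hform, hzero, List.reverse_reverse, List.append_nil,
      List.append_assoc, coreCode] using h
  · have hsteps : (15 * m₁ + 35 * m₂ + 390) * m₂ ≤ (50 * N + 390) * N :=
      Nat.mul_le_mul (by omega) (by omega)
    have hlen := length_flatMap_zeroStep_le (m₁ := m₁) (m₂ := m₂) (N := N) (by omega)
    have hren := length_renameCode_add_le (m := m₁) (f := f) (N := N) (by omega)
    rw [hodd, heven, List.length_reverse, List.length_reverse]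
    nlinarith

theorem must_setupProg (k : ℕ) (q : List Bool)
    (h : R (Store.get {
      first := List.replicate (ones q) true
      len := List.replicate (2 * (readLengths k (afterOnes q)).sum) true
      form := coreCode (ones q) ((readLengths k (afterOnes q)).headD 0)
        (dropLengths k (afterOnes q))
      head := (liftLengths (ones q) (readLengths k (afterOnes q))).flatMap unary })) :
    Must χ .qry (setupProg k) (Store.get { inp := q })
      (77 * q.length ^ 2 + 15 * k * q.length + 587 * q.length + 21 * k + 83) R := by
  have hle := ones_add_length_afterOnes_le q
  have hsum := sum_readLengths_add_length_dropLengths_le k (afterOnes q)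
  have hk := length_readLengths k (afterOnes q)
  have hhead := length_flatMap_liftLengths_le (m₁ := ones q) (ms := readLengths k (afterOnes q))
    (N := q.length) (by omega)
  generalize hms : readLengths k (afterOnes q) = ms at *
  generalize hf : dropLengths k (afterOnes q) = f at *
  refine must_le (must_seq (must_scan (by decide) ?_))
    (?_ : 3 * ones q + 2 + (k * (5 * q.length + 4) + 1 +
      (5 * ((liftLengths (ones q) ms).flatMap unary).length + 4 * (3 * k + 4) + 1 +
      ((6 * f.length + 5 * ones q + 24) * f.length + 2 +
      (66 * q.length ^ 2 + 555 * q.length + 46)))) ≤ _)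
  · simp only [addOnes, Store.update_get, Store.set, Store.get, List.append_nil]
    refine must_seq (must_scanRest (N := q.length) (by simp only; omega) ?_)
    simp only [hms, hf, List.append_nil]
    rw [← length_headItems]
    refine must_seq (must_emit (by decide) ?_ rfl (itemsValue_headItems hk rfl rfl rfl) ?_)
    · simp [headItems, unaryItems]
    simp only [Store.update_get, Store.set, Store.get, List.append_nil]
    refine must_seq (must_renameProg rfl rfl ?_)
    simp only [List.append_nil]
    refine must_formProg (m₂ := ms.headD 0) (f := f) ?_ rfl rfl rfl rfl rfl rfl rfl h
    have := headD_le_sum ms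
    omega
  · have hren : (6 * f.length + 5 * ones q + 24) * f.length ≤ (11 * q.length + 24) * q.length :=
      Nat.mul_le_mul (by omega) (by omega)
    rw [hk] at hhead
    nlinarith

end Must

/-! ### The reduction of `USAT` to `UVAL` -/

/-- The code of a conjunction with `e` up to the code of its second part. -/
def andCode (e : Expr) : List Bool := [true, false] ++ e.encode

/-- The words `head` and `form` are the two parts of the code of a new instance for `q`, whose
formula fixes the letters of `x` from position `i` on. This is no condition if `q` is not a code. -/
def SearchState (n : ℕ) (q : List Bool) (i : ℕ) (head form : List Bool) : Prop :=
  ∀ I : Instance n, I.encode = q → head = (liftLengths I.first I.rest).flatMap unary ∧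
    i ≤ I.first ∧ ∃ c G, I.IsPartial c i G ∧ form = G.encode

theorem searchState_core (k : ℕ) (q : List Bool) : SearchState (k + 1) q (ones q)
    ((liftLengths (ones q) (readLengths k (afterOnes q))).flatMap unary)
    (coreCode (ones q) ((readLengths k (afterOnes q)).headD 0) (dropLengths k (afterOnes q))) := by
  rintro I rfl
  have hk : I.rest.length = k := Nat.succ.inj I.level
  rw [Instance.encode, List.flatMap_cons, List.append_assoc, ones_unary_append,
    afterOnes_unary_append, readLengths_flatMap_unary_append hk,
    dropLengths_flatMap_unary_append hk, coreCode_encode]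
  exact ⟨rfl, le_rfl, _, _, I.isPartial_core, rfl⟩

namespace SearchState

variable {n i : ℕ} {q head form : List Bool} {y : Bool}

theorem literal (h : SearchState n q (i + 1) head form)
    (hy : y ∈ (UVAL n (head ++ (andCode (.searchTest i) ++ form))).1) :
    SearchState n q i head (andCode (.literal i y) ++ form) := by
  intro I hI
  obtain ⟨rfl, hi, c, G, hG, rfl⟩ := h I hI
  exact ⟨rfl, by omega, _, _, hG.literal hi hy, rfl⟩

theorem mem_USAT (h : SearchState n q 0 head form)
    (hy : y ∈ (UVAL n (head ++ (andCode .finalTest ++ form))).1) : y ∈ (USAT n q).1 := by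
  intro I hI
  obtain ⟨rfl, -, c, G, hG, rfl⟩ := h I hI
  exact hG.mem_USAT hy

end SearchState

/-- The items for `andCode (Expr.searchTest j)`. -/
def searchItems : List (List Bool ⊕ Stk) :=
  .inl ([true, false, true, false] ++ (Expr.var 0 1).encode ++ [true, true, true, false] ++
      (Expr.var 0 0).encode) :: varItems 0 2 [.first] ++
    .inl ([true, false] ++ (Expr.not (.var 0 0)).encode ++ [false, true]) :: varItems 0 2 [.first]

/-- The items for `andCode (Expr.literal j y)`. -/
def literalItems : Bool → List (List Bool ⊕ Stk)
  | true => .inl [true, false] :: varItems 0 2 [.first]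
  | false => .inl [true, false, false, true] :: varItems 0 2 [.first]

/-- Call the oracle and continue according to the answer. -/
def ask (p : Bool → Prog Stk) : Prog Stk := seq call (cases .qry fun o => p (o.getD false))

/-- Ask for a letter of the solution and fix it in the formula. -/
def searchStep : Prog Stk :=
  seq (copy .tmp .form .qry) (seq (emit .tmp .qry searchItems) (seq (copy .tmp .head .qry)
    (ask fun y => emit .tmp .form (literalItems y))))

/-- Ask whether the string found is a solution. -/
def finalProg : Prog Stk :=
  seq (copy .tmp .form .qry) (seq (prepend .qry (andCode .finalTest)) (seq (copy .tmp .head .qry)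
    (seq answer (seq (clear .form) (seq (clear .head) (clear .len))))))

/-- The program that answers a query for `USAT` at level `k + 1` with the help of `UVAL`. -/
def usatProg (k : ℕ) : Prog Stk :=
  seq (setupProg k) (seq (forEach .first fun _ => searchStep) finalProg)

section Must

variable {χ : PromiseProblem} {R : (Stk → List Bool) → Prop} {s : Store} {j : ℕ}

theorem itemsValue_searchItems (hfirst : s.first = List.replicate j true) :
    itemsValue s.get searchItems = andCode (.searchTest j) := by
  have hvar := itemsValue_varItems (S := s.get) (i := 0) (c := 2) (l := [.first])
    (by simp [Store.get, hfirst])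
  simp [searchItems, itemsValue_append, itemsValue_inl_cons, hvar, Store.get, hfirst, andCode,
    Expr.searchTest, Expr.iff, Expr.encode]

theorem itemsValue_literalItems (hfirst : s.first = List.replicate j true) (y : Bool) :
    itemsValue s.get (literalItems y) = andCode (.literal j y) := by
  have hvar := itemsValue_varItems (S := s.get) (i := 0) (c := 2) (l := [.first])
    (by simp [Store.get, hfirst])
  cases y <;> simp [literalItems, itemsValue_inl_cons, hvar, Store.get, hfirst, andCode,
    Expr.literal, Expr.encode]

theorem length_andCode_searchTest (j : ℕ) : (andCode (.searchTest j)).length = 2 * j + 39 := by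
  simp only [andCode, Expr.searchTest, Expr.iff, Expr.encode, unary, List.length_cons,
    List.length_append, List.length_replicate, List.length_nil]
  omega

theorem length_andCode_literal_le (j : ℕ) (y : Bool) :
    (andCode (.literal j y)).length ≤ j + 10 := by
  cases y <;> simp [andCode, Expr.literal, Expr.encode, unary] <;> omega

theorem must_ask {p : Bool → Prog Stk} {t : ℕ}
    (h : ∀ y ∈ (χ s.qry).1, Must χ .qry (p y) { s with qry := [] }.get t R) :
    Must χ .qry (ask p) s.get (t + 2) R := by
  refine must_le (must_seq (u := t + 1) (.call fun y hy => must_cases ?_)) (by omega)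
  simpa [Store.update_get, Store.set, Store.get] using h y hy

theorem must_searchStep (hfirst : s.first = List.replicate j true) (htmp : s.tmp = [])
    (hqry : s.qry = []) (h : ∀ y ∈ (χ (s.head ++ (andCode (.searchTest j) ++ s.form))).1,
      R { s with form := andCode (.literal j y) ++ s.form }.get) :
    Must χ .qry searchStep s.get (5 * s.form.length + 5 * s.head.length + 15 * j + 317) R := by
  refine must_le (must_seq (must_copy (by decide) (by decide) (by decide) htmp ?_))
    (?_ : 5 * s.form.length + 4 + (5 * (andCode (.searchTest j)).length + 4 * 10 + 1 +
      (5 * s.head.length + 4 + (5 * (j + 10) + 4 * 5 + 1 + 2))) ≤ _)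
  · simp only [Store.update_get, Store.set, Store.get, hqry, List.append_nil]
    refine must_seq (must_emit (by decide) (by simp [searchItems, varItems, unaryItems]) htmp
      (itemsValue_searchItems hfirst) ?_)
    simp only [Store.update_get, Store.set, Store.get]
    refine must_seq (must_copy (by decide) (by decide) (by decide) htmp ?_)
    simp only [Store.update_get, Store.set, Store.get]
    refine must_ask fun y hy => must_le (must_emit (by decide)
      (by cases y <;> simp [literalItems, varItems, unaryItems]) htmp
      (w := andCode (.literal j y)) ?_ ?_) ?_
    · exact itemsValue_literalItems (by exact hfirst) y
    · simp only [Store.update_get, Store.set, Store.get]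
      rw [← hqry]
      exact h y hy
    · have := length_andCode_literal_le j y
      have : (literalItems y).length = 5 := by cases y <;> rfl
      omega
  · rw [length_andCode_searchTest]
    omega

theorem must_search {n i N B H : ℕ} {q : List Bool} (hfirst : s.first = List.replicate i true)
    (htmp : s.tmp = []) (hqry : s.qry = []) (hi : i ≤ N) (hH : s.head.length ≤ H)
    (hB : s.form.length + i * (i + 10) ≤ B) (hs : SearchState n q i s.head s.form)
    (h : ∀ form, form.length ≤ B → SearchState n q 0 s.head form →
      R { s with first := [], form := form }.get) :
    Must (UVAL n) .qry (forEach .first fun _ => searchStep) s.get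
      ((5 * B + 5 * H + 15 * N + 318) * N + 2) R := by
  refine must_le (must_forEach (t := 5 * B + 5 * H + 15 * N + 317) (fun l S =>
    ∃ j ≤ N, l = List.replicate j true ∧ ∃ form, form.length + j * (j + 10) ≤ B ∧
      SearchState n q j s.head form ∧ S = { s with first := l, form := form }.get)
    ?_ ?_ ⟨i, hi, hfirst, s.form, hB, hs, rfl⟩ ?_) ?_
  · rintro l _ ⟨j, -, -, form, -, -, rfl⟩
    rfl
  · rintro b l _ ⟨_ | j, hj, hl, form, hform, hstate, rfl⟩
    · cases hl
    obtain ⟨rfl, rfl⟩ := List.cons.inj hl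
    have hsq : (j + 1) * (j + 1 + 10) = j * (j + 10) + 2 * j + 11 := by ring
    simp only [Store.update_get, Store.set]
    refine must_le (must_searchStep rfl htmp hqry fun y hy => ?_) (by simp only; omega)
    refine ⟨j, by omega, rfl, _, ?_, hstate.literal hy, rfl⟩
    have := length_andCode_literal_le j y
    rw [List.length_append]
    omega
  · rintro _ ⟨j, -, hj, form, hform, hstate, rfl⟩
    obtain rfl := (List.replicate_eq_nil_iff true).1 hj.symm
    exact h form (by omega) hstate
  · simp only [Store.get, hfirst, List.length_replicate]
    gcongr

theorem must_finalProg {len form head : List Bool}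
    (h : ∀ y ∈ (χ (head ++ (andCode .finalTest ++ form))).1, R (Store.get { inp := [y] })) :
    Must χ .qry finalProg (Store.get { len := len, form := form, head := head })
      (7 * form.length + 7 * head.length + 2 * len.length + 54) R := by
  refine must_le (must_seq (must_copy (by decide) (by decide) (by decide) rfl ?_))
    (?_ : 5 * form.length + 4 + (31 + (5 * head.length + 4 + (5 + (2 * form.length + 2 +
      (2 * head.length + 2 + (2 * len.length + 2)))))) ≤ _)
  · simp only [Store.update_get, Store.set, Store.get, List.append_nil]
    refine must_seq (must_prepend ?_)
    simp only [Store.update_get, Store.set, Store.get]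
    refine must_seq (must_copy (by decide) (by decide) (by decide) rfl ?_)
    simp only [Store.update_get, Store.set, Store.get]
    refine must_seq (must_answer fun y hy => must_seq (must_clear ?_))
    simp only [Store.update_get, Store.set]
    refine must_seq (must_clear ?_)
    simp only [Store.update_get, Store.set]
    refine must_clear ?_
    simp only [Store.update_get, Store.set]
    exact h y hy
  · omega

end Must

open Polynomial in
theorem usatProg_computes (k : ℕ) :
    (usatProg k).Computes .inp .qry (USAT (k + 1)) (UVAL (k + 1)) := by
  refine ⟨77 * X ^ 2 + 15 * C k * X + 587 * X + 21 * C k + 83 +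
    (5 * (13 * X ^ 2 + 79 * X + 29) + 5 * (C k * (2 * X + 1) + X + 3) + 15 * X + 318) * (X + 2),
    fun q => ?_⟩
  have hq := ones_add_length_afterOnes_le q
  have hsum := sum_readLengths_add_length_dropLengths_le k (afterOnes q)
  have hhead := length_flatMap_liftLengths_le (m₁ := ones q) (ms := readLengths k (afterOnes q))
    (N := q.length) (by omega)
  rw [length_readLengths] at hhead
  have hcore := length_coreCode_le (m₁ := ones q) (m₂ := (readLengths k (afterOnes q)).headD 0)
    (f := dropLengths k (afterOnes q)) (N := q.length)
    (by have := headD_le_sum (readLengths k (afterOnes q)); omega)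
  have hsq : ones q * (ones q + 10) ≤ q.length * (q.length + 10) :=
    Nat.mul_le_mul (by omega) (by omega)
  rw [Store.update_nil_get]
  refine must_le (must_seq (must_setupProg k q (must_seq (must_search (N := q.length)
    (B := 13 * q.length ^ 2 + 79 * q.length + 29) rfl rfl rfl (by omega) hhead ?_
    (searchState_core k q) fun form hform hstate => must_le
      (u := 7 * (13 * q.length ^ 2 + 79 * q.length + 29) +
        7 * (k * (2 * q.length + 1) + q.length + 3) + 4 * q.length + 54)
      (must_finalProg fun y hy =>
        ⟨y, hstate.mem_USAT hy, (Store.update_nil_get .inp [y]).symm⟩) ?_)))) ?_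
  · simp only
    nlinarith
  · simp only [List.length_replicate]
    omega
  · simp only [eq_natCast, eval_add, eval_mul, eval_ofNat, eval_pow, eval_X, eval_natCast,
      Nat.cast_id, eval_one]
    nlinarith

theorem usat_weakClosure_subset (k : ℕ) : UDeltaSucc (k + 1) ⊆ weakClosure (UVAL (k + 1)) :=
  fun _ h => TuringReducible.of_computes (usatProg_computes k) h

end PromiseHierarchy

theorem theorem12 (n : ℕ) (hn : 1 ≤ n) :
    PromiseHierarchy.weakClosure (PromiseHierarchy.UVAL n) =
      PromiseHierarchy.UDeltaSucc n := by
  obtain ⟨k, rfl⟩ := Nat.exists_eq_add_of_le' hn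
  exact (PromiseHierarchy.uval_weakClosure_subset _).antisymm
    (PromiseHierarchy.usat_weakClosure_subset k)
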